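/- **Conventions.** $H$ is a finite abelian group, $\mu$ is density relative to the ambient finite set, $[\![k]\!]=\{0,1\}^k$, $|\omega|=\sum_i\omega_i$. A $k$-cube is a map $c\colon[\![k]\!]\to H$ of the form $c(\omega)=x+\sum_{i:\,\omega_i=1}h_i$ with $x,h_1,\dots,h_k\in H$; $C^k(H)$ is the set of $k$-cubes; $0$-cubes are identified with elements of $H$. For a real function $f$ defined at the vertices of $c$ put $\partial^kf(c)=\sum_{\omega\in[\![k]\!]}(-1)^{|\omega|}f(c(\omega))$. Also $\partial_hf(x)=f(x)-f(x+h)$. For $X\subseteq H$, a function $g\colon X\to\mathbb R$ is an *approximate polynomial of degree $s$ and parameter $\delta>0$* if at least $\delta|H|^{s+2}$ tuples $(x,h_1,\dots,h_{s+1})\in H^{s+2}$ are such that $\partial_{h_1}\cdots\partial_{h_{s+1}}g(x)$ is well defined (i.e. all $x+\sum_{i\in I}h_i$, $I\subseteq\{1,\dots,s+1\}$, lie in $X$) and equal to $0$. A *system of cubes of degree $s\ge 0$ and parameter $\delta>0$* consists of sets $S_k\subseteq C^k(H)$, $0\le k\le s+1$, such that (i) each $S_k$ is closed under permuting the coordinates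 of $[\![k]\!]$ and under replacing a coordinate $\omega_i$ by $1-\omega_i$; (ii) if $c\in S_k$, then the restriction of $c$ to every $d$-dimensional face of $[\![k]\!]$ (identified with $[\![d]\!]$ by its non-constant coordinates in increasing order) lies in $S_d$; (iii) for $0\le k\le s$ and $c\in S_k$ there are at least $\delta|H|$ elements $h\in H$ such that the $(k+1)$-cube equal to $c$ on the face $\omega_{k+1}=0$ and to $c+h$ on the face $\omega_{k+1}=1$ lies in $S_{k+1}$. Let $f=(f_{i,j})_{0\le i\le s,\ 1\le j\le d_i}$ be a tuple of real functions on a set containing $S_0$. A function $g\colon S_0\to\mathbb R$ obeys the *$(f,k,t,M)$-derivatives condition* on $S_k$ (where $0\le t\le s+1$ and $M\ge1$) if there are integers $b_{i,j}(c,\omega)$ ($c\in S_k$, $\omega\in[\![k]\!]$, $0\le i<t$, $1\le j\le d_i$) such that, for all $c\in S_k$, $$\partial^kg(c)=\sum_{\omega\in[\![k]\!]}(-1)^{|\omega|}\sum_{i<t}\sum_{j=1}^{d_i}b_{i,j}(c,\omega)\,f_{i,j}(c(\omega)),\qquad \sum_{j=1}^{d_r}|b_{r,j}(c,\omega)|\le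 M^{t-r}\quad(\omega\in[\![k]\!],\ 0\le r<t).$$ The tuple $f$ is an *$(s,d,M)$-polynomial hierarchy* on a non-empty system of cubes $S_0,\dots,S_{s+1}$ of degree $s$ if, for all $0\le i\le s$ and $1\le j\le d_i$, the function $f_{i,j}$ obeys the $(f,i+1,i,M)$-derivatives condition on $S_{i+1}$. **Corollary 2.9.** For every integer $s\ge1$ there is a constant $C=C(s)>0$ such that the following holds. Let $H$ be a finite abelian group, $X\subseteq H$, let $g\colon X\to\mathbb R$ be an approximate polynomial of degree $s$ and parameter $\delta>0$, and let $0<\varepsilon<1$. Then there exist a system of cubes $S_0,\dots,S_{s+1}$ in $H$ of degree $s$ and parameter $1-\varepsilon$, an $(s-1,d,M)$-polynomial hierarchy $f$ on $S_0,\dots,S_s$, a set $Y\subseteq S_0\cap X$ and a function $\tilde g\colon S_0\to\mathbb R$ such that * $g|_Y=\tilde g|_Y$ and $\mu(Y)\ge C^{-1}\delta^{C}$; * $\tilde g$ obeys the $(f,s+1,s,M)$-derivatives condition on $S_{s+1}$; * $D=\sum_{i=0}^{s-1}d_i$ and $M$ satisfy $D,M\le C(\varepsilon\delta)^{-C}$.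 -/

import Mathlib

namespace PolyHier

/-- The discrete cube `⟦k⟧ = {0,1}^k`, with `false` as `0` and `true` as `1`. -/
abbrev DCube (k : ℕ) : Type := Fin k → Bool

/-- `|ω|`, the number of coordinates equal to `1`. -/
def weight {k : ℕ} (ω : DCube k) : ℕ :=
  (Finset.univ.filter fun i => ω i = true).card

/-- `∠(x; h₁, …, h_k)`, the configuration `ω ↦ x + ω · h`. -/
def angle {H : Type*} [AddCommGroup H] {k : ℕ} (x : H) (h : Fin k → H) : DCube k → H :=
  fun ω => x + ∑ i, if ω i = true then h i else 0

/-- `C^k(H)`, the set of `k`-cubes. -/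
def cubes (H : Type*) [AddCommGroup H] (k : ℕ) : Set (DCube k → H) :=
  {c | ∃ (x : H) (h : Fin k → H), c = angle x h}

/-- `∂^k f (c) = ∑_ω (-1)^{|ω|} f(c(ω))`. -/
def cubeDeriv {H : Type*} {k : ℕ} (f : H → ℝ) (c : DCube k → H) : ℝ :=
  ∑ ω : DCube k, (-1 : ℝ) ^ weight ω * f (c ω)

/-- The discrete derivative `∂_h f (x) = f(x) - f(x+h)`. -/
def discreteDeriv {H : Type*} [AddCommGroup H] (h : H) (f : H → ℝ) : H → ℝ :=
  fun x => f x - f (x + h)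

/-- The iterated discrete derivative `∂_{h₁} ⋯ ∂_{h_n} f`. -/
def iterDeriv {H : Type*} [AddCommGroup H] : {n : ℕ} → (Fin n → H) → (H → ℝ) → H → ℝ
  | 0, _, f => f
  | _ + 1, h, f => discreteDeriv (h 0) (iterDeriv (Fin.tail h) f)

/-- The density `|Y| / |H|`. -/
noncomputable def density {H : Type*} (Y : Set H) : ℝ :=
  (Y.ncard : ℝ) / (Nat.card H : ℝ)

/-- The restriction of `g` to `X` is an approximate polynomial of degree `s` and parameter `δ`.
A function on `X` is represented by a function on `H` whose values off `X` are never used: the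
iterated derivative at `(x, h₁, …, h_{s+1})` is well defined on `X` exactly when all the points
`x + ω · h` lie in `X`, and only such tuples are counted. -/
def IsApproxPoly {H : Type*} [AddCommGroup H] (s : ℕ) (δ : ℝ) (X : Set H) (g : H → ℝ) : Prop :=
  0 < δ ∧
    δ * (Nat.card H : ℝ) ^ (s + 2) ≤
      ({p : H × (Fin (s + 1) → H) |
          (∀ ω, angle p.1 p.2 ω ∈ X) ∧ iterDeriv p.2 g p.1 = 0}.ncard : ℝ)

/-- `[c, c']_i`: the configuration equal to `c` on the face `ω_i = 0` and to `c'` on the face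
`ω_i = 1`. -/
def glue {A : Type*} {k : ℕ} (i : Fin (k + 1)) (c c' : DCube k → A) : DCube (k + 1) → A :=
  fun ω => if ω i = true then c' (i.removeNth ω) else c (i.removeNth ω)

/-- The inclusion `ι_F : ⟦d⟧ → ⟦k⟧` of the face `F` of dimension `d` whose active coordinates are
`e 0 < e 1 < ⋯`, and on which every other coordinate `i` is fixed at `η i`. Every face
`{ω | η₀ ⊆ ω ⊆ η₁}` is of this form, and conversely. -/
noncomputable def faceIncl {d k : ℕ} (e : Fin d ↪o Fin k) (η : DCube k) : DCube d → DCube k :=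
  fun ω => Function.extend e ω η

/-- Systems of cubes of degree `s` and parameter `δ > 0`. Only `S k` with `k ≤ s + 1` is relevant. -/
structure IsCubeSystem {H : Type*} [AddCommGroup H] (s : ℕ) (δ : ℝ)
    (S : (k : ℕ) → Set (DCube k → H)) : Prop where
  pos : 0 < δ
  subset_cubes : ∀ k ≤ s + 1, S k ⊆ cubes H k
  /-- coordinate permutations -/
  perm : ∀ k ≤ s + 1, ∀ c ∈ S k, ∀ σ : Equiv.Perm (Fin k), (fun ω => c (ω ∘ σ)) ∈ S k
  /-- coordinate reflections -/
  reflect : ∀ k ≤ s + 1, ∀ c ∈ S k, ∀ i : Fin k,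
    (fun ω => c (Function.update ω i (!(ω i)))) ∈ S k
  faces : ∀ k ≤ s + 1, ∀ c ∈ S k, ∀ (d : ℕ) (e : Fin d ↪o Fin k) (η : DCube k),
    c ∘ faceIncl e η ∈ S d
  popular : ∀ k ≤ s, ∀ c ∈ S k,
    δ * (Nat.card H : ℝ) ≤
      ({h : H | glue (Fin.last k) c (fun ω => c ω + h) ∈ S (k + 1)}.ncard : ℝ)

/-- `S_0` as a subset of `H`, a `0`-cube being identified with its only value. -/
def vertexSet {H : Type*} (S : (k : ℕ) → Set (DCube k → H)) : Set H :=
  {x | (fun _ => x) ∈ S 0}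

/-- `g` obeys the `(f, k, t, M)`-derivatives condition on `S`. The tuple `f` consists of the
functions `f i j` for `j < d i`, and only those with `i < t` are used. All functions are evaluated
only at vertices of the cubes in `S`, so functions that are defined on a set containing these
vertices are represented by arbitrary extensions to `H`; likewise `b c` is used only for
`c ∈ S`. -/
def DerivCondition {H : Type*} {d : ℕ → ℕ} (f : (i : ℕ) → Fin (d i) → H → ℝ) (k t : ℕ) (M : ℝ)
    (S : Set (DCube k → H)) (g : H → ℝ) : Prop :=
  1 ≤ M ∧
    ∃ b : (DCube k → H) → DCube k → (i : ℕ) → Fin (d i) → ℤ,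
      (∀ c ∈ S, cubeDeriv g c =
        ∑ ω : DCube k, (-1 : ℝ) ^ weight ω *
          ∑ i ∈ Finset.range t, ∑ j : Fin (d i), (b c ω i j : ℝ) * f i j (c ω)) ∧
      (∀ c ∈ S, ∀ ω : DCube k, ∀ r < t, ∑ j : Fin (d r), |(b c ω r j : ℝ)| ≤ M ^ (t - r))

/-- `f` is an `(s, d, M)`-polynomial hierarchy on `S_0, …, S_{s+1}`. Only `d i` and `f i j` with
`i ≤ s`, and `S k` with `k ≤ s + 1`, are relevant. -/
structure IsPolyHierarchy {H : Type*} [AddCommGroup H] (s : ℕ) (d : ℕ → ℕ) (M : ℝ)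
    (f : (i : ℕ) → Fin (d i) → H → ℝ) (S : (k : ℕ) → Set (DCube k → H)) : Prop where
  one_le : 1 ≤ M
  system : ∃ δ : ℝ, IsCubeSystem s δ S
  nonempty : (S 0).Nonempty
  deriv : ∀ i ≤ s, ∀ j : Fin (d i), DerivCondition f (i + 1) i M (S (i + 1)) (f i j)

end PolyHier

/-!
The proof replaces systems of cubes by exceptional sets of cubes. `InverseStatement s` asserts that
if `∂^{s+1} g` vanishes on a set `G` of `(s+1)`-cubes of probability `δ`, then `g` agrees, on a set
`Y` containing all vertices of many cubes of `G`, with a function `q` for which there is a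
polynomial hierarchy such that all derivatives conditions hold on all but a proportion `ε` of the
cubes of each dimension. The number of cubes of `G` inside `Y` is bounded below independently of
`ε`. It is proved by induction on `s`; all bounds are powers of `δ` and of `(ε δ)⁻¹`, which absorb
constants because `δ, ε ≤ 1/2`.

For the inductive step, the case of smaller degree is applied to `x ↦ g x - g (x + h)` for each
direction `h` and each coordinate of the cube, passing to a smaller set of cubes each time
(`InverseStatement.exists_edges`). The result is a dense set of cubes along whose edges
`g x - g (x + h) = q_h x` with `q_h` almost polynomial of degree `s - 1`. Call two points joined if
the difference of their values is given in this way. Dependent random choice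
(`exists_linked_set`) yields a set `Y` containing many of the cubes, any two points of which are
connected by many walks of bounded length. Now choose finitely many random shifts
(`exists_shifts`). Almost every point `x` is shifted into `Y` by one of them, and the extension of
`g` to `x` is the value at the shifted point. Almost every cube `c` is moved by shifts of its
vertices to a cube with all vertices in `Y` at which the derivative of `g` vanishes, so that the
derivative of the extension at `c` is an alternating sum of differences `g (x + v) - g (x + v')`,
where `x` is a vertex of `c` and `x + v`, `x + v'` lie in `Y`. A walk between these points whose
intermediate points are also of the form `x + w`, for shifts `w`, writes the difference as a sum of
boundedly many values at `x` of translates of functions `± q_h` with `h` a difference of shifts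
(`exists_extension`). These translates are finitely many, and they form the new top level of the
hierarchy; their own hierarchies are the lower levels.

Finally, a symmetric family of sets containing almost all cubes of each dimension contains a system
of cubes (`exists_isCubeSystem`): keep the cubes all of whose faces can be extended repeatedly in
most directions, and most of whose translates can be so extended.
-/

universe u

namespace PolyHier

open Finset

open scoped BigOperators

/-! ### Uniform probability on finite types -/

/-- The probability that `p` holds at a uniformly random element of the finite type `α`. -/
noncomputable def pr {α : Type*} [Fintype α] (p : α → Prop) : ℝ := by
  classical exact 𝔼 a, if p a then (1 : ℝ) else 0

section Probability

variable {α β : Type*} [Fintype α] [Fintype β]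

open Classical in
lemma pr_def (p : α → Prop) : pr p = 𝔼 a, if p a then (1 : ℝ) else 0 := by
  unfold pr; congr

lemma pr_nonneg (p : α → Prop) : 0 ≤ pr p := by
  classical
  rw [pr_def]
  exact expect_nonneg fun a _ => by split_ifs <;> norm_num

lemma pr_mono {p q : α → Prop} (h : ∀ a, p a → q a) : pr p ≤ pr q := by
  classical
  rw [pr_def, pr_def]
  refine expect_le_expect fun a _ => ?_
  by_cases hp : p a
  · simp [hp, h a hp]
  · simp only [hp, if_false]; split_ifs <;> norm_num

lemma pr_le_one [Nonempty α] (p : α → Prop) : pr p ≤ 1 := by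
  classical
  rw [pr_def]
  exact expect_le univ_nonempty fun a _ => by split_ifs <;> norm_num

lemma pr_congr {p q : α → Prop} (h : ∀ a, p a ↔ q a) : pr p = pr q := by
  congr 1; funext a; exact propext (h a)

lemma pr_or_le (p q : α → Prop) : pr (fun a => p a ∨ q a) ≤ pr p + pr q := by
  classical
  rw [pr_def, pr_def, pr_def, ← expect_add_distrib]
  refine expect_le_expect fun a _ => ?_
  by_cases hp : p a <;> by_cases hq : q a <;> simp [hp, hq]

lemma pr_false : pr (fun _ : α => False) = 0 := by
  simp [pr_def]

lemma pr_le_and_add (p q : α → Prop) : pr p ≤ pr (fun a => p a ∧ q a) + pr (fun a => ¬ q a) := by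
  refine le_trans (pr_mono fun a ha => ?_) (pr_or_le _ _)
  by_cases hq : q a
  · exact Or.inl ⟨ha, hq⟩
  · exact Or.inr hq

lemma pr_not [Nonempty α] (p : α → Prop) : pr (fun a => ¬ p a) = 1 - pr p := by
  classical
  rw [pr_def, pr_def, eq_sub_iff_add_eq, ← expect_add_distrib]
  rw [← Fintype.expect_one (ι := α) (M := ℝ)]
  refine expect_congr rfl fun a _ => ?_
  by_cases hp : p a <;> simp [hp]

lemma pr_exists_mem_le {ι : Type*} (s : Finset ι) (p : ι → α → Prop) :
    pr (fun a => ∃ i ∈ s, p i a) ≤ ∑ i ∈ s, pr (p i) := by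
  classical
  induction s using Finset.induction_on with
  | empty => simp [pr_false]
  | insert i s hi ih =>
    rw [sum_insert hi]
    refine le_trans (le_trans (pr_mono ?_) (pr_or_le (p i) (fun a => ∃ i ∈ s, p i a)))
      (add_le_add le_rfl ih)
    rintro a ⟨j, hj, hp⟩
    rcases mem_insert.1 hj with rfl | hj
    · exact Or.inl hp
    · exact Or.inr ⟨j, hj, hp⟩

lemma pr_exists_le {ι : Type*} [Fintype ι] (p : ι → α → Prop) :
    pr (fun a => ∃ i, p i a) ≤ ∑ i, pr (p i) := by
  simpa using pr_exists_mem_le univ p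

lemma pr_prod (p : α × β → Prop) : pr p = 𝔼 a, pr fun b => p (a, b) := by
  classical
  simp only [pr_def]
  rw [← univ_product_univ, expect_product]

lemma pr_prod' (p : α × β → Prop) : pr p = 𝔼 b, pr fun a => p (a, b) := by
  classical
  rw [pr_prod]
  simp only [pr_def]
  rw [expect_comm]

lemma pr_equiv (e : α ≃ β) (p : β → Prop) : pr (fun a => p (e a)) = pr p := by
  classical
  rw [pr_def, pr_def]
  exact Fintype.expect_equiv e _ _ fun a => rfl

lemma pr_fst [Nonempty β] (p : α → Prop) : pr (fun q : α × β => p q.1) = pr p := by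
  classical
  rw [pr_prod]
  simp only [pr_def, Fintype.expect_const]

/-- Independence of the coordinates of a random point of `α × β`. -/
lemma pr_prod_and (p : α → Prop) (q : β → Prop) :
    pr (fun x : α × β => p x.1 ∧ q x.2) = pr p * pr q := by
  classical
  rw [pr_prod, pr_def p, expect_mul]
  refine expect_congr rfl fun a _ => ?_
  by_cases ha : p a <;> simp [ha, pr_false]

lemma pr_const [Nonempty α] (P : Prop) [Decidable P] :
    pr (fun _ : α => P) = if P then 1 else 0 := by
  classical
  rw [pr_def]
  by_cases h : P <;> simp [h]

/-- Markov's inequality. -/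
lemma pr_mul_le_expect {f : α → ℝ} (hf : ∀ a, 0 ≤ f a) (c : ℝ) :
    pr (fun a => c ≤ f a) * c ≤ 𝔼 a, f a := by
  classical
  rw [pr_def, expect_mul]
  refine expect_le_expect fun a _ => ?_
  split_ifs with h
  · simpa using h
  · simpa using hf a

lemma pr_le_div {f : α → ℝ} (hf : ∀ a, 0 ≤ f a) {c κ : ℝ} (hc : 0 < c) (h : 𝔼 a, f a ≤ κ) :
    pr (fun a => c ≤ f a) ≤ κ / c := by
  rw [le_div_iff₀ hc]
  exact (pr_mul_le_expect hf c).trans h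

/-- Independence of the coordinates of a random function. -/
lemma expect_pi_prod {ι : Type*} [Fintype ι] [DecidableEq ι] (f : ι → α → ℝ) :
    𝔼 r : ι → α, ∏ i, f i (r i) = ∏ i, 𝔼 a, f i a := by
  classical
  simp only [Fintype.expect_eq_sum_div_card]
  rw [prod_div_distrib, Finset.prod_univ_sum, Fintype.piFinset_univ]
  congr 1
  simp

lemma pr_pi_forall {ι : Type*} [Fintype ι] [DecidableEq ι] (p : ι → α → Prop) :
    pr (fun r : ι → α => ∀ i, p i (r i)) = ∏ i, pr (p i) := by
  classical
  simp only [pr_def]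
  rw [← expect_pi_prod]
  refine expect_congr rfl fun r _ => ?_
  by_cases h : ∀ i, p i (r i)
  · simp [h]
  · rw [if_neg h]
    push Not at h
    obtain ⟨i, hi⟩ := h
    exact (prod_eq_zero (mem_univ i) (by simp [hi])).symm

lemma pr_pi_eval {ι : Type*} [Fintype ι] [DecidableEq ι] [Nonempty α] (i : ι) (p : α → Prop) :
    pr (fun r : ι → α => p (r i)) = pr p := by
  classical
  have h := pr_pi_forall (fun j a => j = i → p a)
  rw [prod_eq_single i] at h
  · simpa using h
  · intro j _ hj
    simp only [hj, false_imp_iff]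
    rw [pr_const]; simp
  · simp

/-- Random sampling: if `A x` has probability at least `η` for `x` in `P`, then some `m` points
meet `A x` for all `x ∈ P` outside of a set of probability `(1 - η) ^ m`. -/
lemma exists_sample [Nonempty α] [Nonempty β] (A : α → β → Prop) (P : α → Prop) {η : ℝ}
    (hη : η ≤ 1) (h : ∀ x, P x → η ≤ pr (A x)) (m : ℕ) :
    ∃ u : Fin m → β, pr (fun x => P x ∧ ∀ j, ¬ A x (u j)) ≤ (1 - η) ^ m := by
  have key : 𝔼 u : Fin m → β, pr (fun x => P x ∧ ∀ j, ¬ A x (u j)) ≤ (1 - η) ^ m := by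
    rw [← pr_prod' (fun q : α × (Fin m → β) => P q.1 ∧ ∀ j, ¬ A q.1 (q.2 j)), pr_prod]
    refine expect_le univ_nonempty fun x _ => ?_
    by_cases hx : P x
    · simp only [hx, true_and]
      rw [pr_pi_forall (fun _ b => ¬ A x b)]
      simp only [pr_not, prod_const, card_univ, Fintype.card_fin]
      have := pr_le_one (A x)
      exact pow_le_pow_left₀ (by linarith) (by linarith [h x hx]) m
    · simp only [hx, false_and, pr_false]
      exact pow_nonneg (by linarith) m
  obtain ⟨u, -, hu⟩ := exists_le_of_expect_le univ_nonempty key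
  exact ⟨u, hu⟩

lemma one_sub_pow_le {η : ℝ} (h0 : 0 < η) (h1 : η ≤ 1) {m : ℕ} (hm : 0 < m) :
    (1 - η) ^ m ≤ 1 / (m * η) := by
  have hm' : (0 : ℝ) < m := by exact_mod_cast hm
  have h2 : 1 + m * η ≤ (1 + η) ^ m := one_add_mul_le_pow (by linarith) m
  have h3 : (1 - η) ^ m * (1 + η) ^ m ≤ 1 := by
    rw [← mul_pow]
    exact pow_le_one₀ (by nlinarith) (by nlinarith)
  have h4 : 0 ≤ (1 - η) ^ m := pow_nonneg (by linarith) m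
  rw [le_div_iff₀ (by positivity)]
  nlinarith

/-- If a random pair satisfies `p` with probability at least `δ`, then with probability at least
`δ / 2` the first coordinate has a fibre of probability at least `δ / 2`. -/
lemma half_le_pr_fiber [Nonempty α] [Nonempty β] (p : α × β → Prop) {δ : ℝ} (hδ : 0 ≤ δ)
    (h : δ ≤ pr p) : δ / 2 ≤ pr fun a => δ / 2 ≤ pr fun b => p (a, b) := by
  classical
  have h1 : 𝔼 a, pr (fun b => p (a, b)) ≤
      (𝔼 a, if δ / 2 ≤ pr (fun b => p (a, b)) then (1 : ℝ) else 0) + δ / 2 := by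
    rw [← Fintype.expect_const (ι := α) (δ / 2), ← expect_add_distrib]
    refine expect_le_expect fun a _ => ?_
    rw [Fintype.expect_const]
    split_ifs with hc
    · linarith [pr_le_one (fun b => p (a, b))]
    · linarith
  rw [← pr_prod, ← pr_def] at h1
  linarith

lemma mul_le_pr_prod (p : α × β → Prop) (q : α → Prop) {c d : ℝ} (hd : 0 ≤ d)
    (hq : c ≤ pr q) (h : ∀ a, q a → d ≤ pr fun b => p (a, b)) : c * d ≤ pr p := by
  classical
  refine (mul_le_mul_of_nonneg_right hq hd).trans ?_
  rw [pr_prod, pr_def, expect_mul]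
  refine expect_le_expect fun a _ => ?_
  split_ifs with hc
  · simpa using h a hc
  · simpa using pr_nonneg _

lemma pr_eq_ncard_div (p : α → Prop) : pr p = ({a | p a}.ncard : ℝ) / Nat.card α := by
  classical
  rw [pr_def, Fintype.expect_eq_sum_div_card, Nat.card_eq_fintype_card, Finset.sum_boole,
    Set.ncard_eq_toFinset_card']
  simp

end Probability

section Translation

variable {H : Type*} [AddCommGroup H] [Fintype H]

lemma pr_add_right (a : H) (p : H → Prop) : pr (fun x => p (x + a)) = pr p :=
  pr_equiv (Equiv.addRight a) p

lemma pr_base_add {κ : Type*} [Fintype κ] (a : κ → H) (p : H × κ → Prop) :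
    pr (fun q : H × κ => p (q.1 + a q.2, q.2)) = pr p := by
  rw [pr_prod', pr_prod']
  refine expect_congr rfl fun b _ => ?_
  exact pr_add_right (a b) fun x => p (x, b)

lemma pr_angle {k : ℕ} (ω : DCube k) (p : H × (Fin k → H) → Prop) :
    pr (fun q : H × (Fin k → H) => p (angle q.1 q.2 ω, q.2)) = pr p :=
  pr_base_add (fun h : Fin k → H => ∑ i, if ω i = true then h i else 0) p

lemma pr_vertex {k : ℕ} (ω : DCube k) (p : H → Prop) :
    pr (fun q : H × (Fin k → H) => p (angle q.1 q.2 ω)) = pr p := by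
  rw [pr_angle ω (fun q => p q.1), pr_fst]

/-- A vertex and a side of a random cube are independent and uniform. -/
lemma pr_vertex_side {k : ℕ} (ω : DCube k) (i : Fin k) (p : H → H → Prop) :
    pr (fun q : H × (Fin k → H) => p (angle q.1 q.2 ω) (q.2 i)) =
      pr fun q : H × H => p q.1 q.2 := by
  rw [pr_angle ω (fun q => p q.1 (q.2 i)), pr_prod, pr_prod]
  exact expect_congr rfl fun x _ => pr_pi_eval i (p x)

end Translation

/-! ### Dependent random choice for cubes -/

/-- On `(0, 1/2]` every positive constant dominates a power. -/
lemma exists_pow_le {c : ℝ} (hc : 0 < c) : ∃ m : ℕ, ∀ δ : ℝ, 0 < δ → δ ≤ 1 / 2 → δ ^ m ≤ c := by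
  obtain ⟨m, hm⟩ := exists_pow_lt_of_lt_one hc (by norm_num : (1 / 2 : ℝ) < 1)
  exact ⟨m, fun δ h0 h1 => (pow_le_pow_left₀ h0.le h1 m).trans hm.le⟩

lemma exists_pow_le_mul_pow {c : ℝ} (hc : 0 < c) (n : ℕ) :
    ∃ m : ℕ, ∀ δ : ℝ, 0 < δ → δ ≤ 1 / 2 → δ ^ m ≤ c * δ ^ n := by
  obtain ⟨m, hm⟩ := exists_pow_le hc
  refine ⟨m + n, fun δ h0 h1 => ?_⟩
  rw [pow_add]
  exact mul_le_mul_of_nonneg_right (hm δ h0 h1) (by positivity)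

section DependentChoice

variable {H : Type*} [AddCommGroup H]

lemma angle_update {k : ℕ} (x : H) (h : Fin k → H) (ω : DCube k) (i : Fin k) (hi : ω i = false) :
    angle x h (Function.update ω i true) = angle x h ω + h i := by
  unfold angle
  rw [add_assoc]
  congr 1
  have : h i = ∑ j, if j = i then h j else 0 := by simp
  rw [this, ← sum_add_distrib]
  refine sum_congr rfl fun j _ => ?_
  by_cases hj : j = i
  · subst hj; simp [hi]
  · simp [hj]

lemma angle_flip {k : ℕ} (x : H) (h : Fin k → H) (ω : DCube k) (i : Fin k) :
    angle x h (Function.update ω i (!ω i)) =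
      angle x h ω + (if ω i = true then - h i else h i) := by
  cases hi : ω i
  · simp [angle_update x h ω i hi]
  · have := angle_update x h (Function.update ω i false) i (by simp)
    rw [Function.update_idem, ← hi, Function.update_eq_self] at this
    simp [this]

variable [Fintype H]

lemma pr_vertex_neighbour {k : ℕ} (ω : DCube k) (i : Fin k) (p : H → H → Prop) :
    pr (fun q : H × (Fin k → H) =>
      p (angle q.1 q.2 ω) (angle q.1 q.2 (Function.update ω i (!ω i)))) =
      pr fun q : H × H => p q.1 q.2 := by
  simp only [angle_flip]
  rw [pr_vertex_side ω i (fun x y => p x (x + if ω i = true then - y else y)), pr_prod, pr_prod]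
  refine expect_congr rfl fun x _ => ?_
  cases ω i
  · simpa using pr_equiv (Equiv.addLeft x) (fun y => p x y)
  · simpa using pr_equiv ((Equiv.neg H).trans (Equiv.addLeft x)) (fun y => p x y)

/-- Few cubes have a vertex of low degree that is joined to a neighbouring vertex. -/
lemma pr_low_degree_le {k : ℕ} (R : H → H → Prop) (ω : DCube k) (i : Fin k) {η : ℝ} (hη : 0 ≤ η) :
    pr (fun q : H × (Fin k → H) => pr (R (angle q.1 q.2 ω)) < η ∧
      R (angle q.1 q.2 ω) (angle q.1 q.2 (Function.update ω i (!ω i)))) ≤ η := by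
  rw [pr_vertex_neighbour ω i (fun x y => pr (R x) < η ∧ R x y), pr_prod]
  refine expect_le univ_nonempty fun x _ => ?_
  by_cases hx : pr (R x) < η
  · simpa [hx] using hx.le
  · simpa [hx, pr_false] using hη

/-- Dependent random choice for cubes: if every vertex of every cube in `G` is joined by `R` to a
neighbouring vertex, then one point `r ω` can be chosen for each `ω` such that many cubes have every
vertex `ω` joined to `r ω`, while few pairs of neighbours of `r ω` have few common neighbours. -/
lemma exists_roots {k : ℕ} (R : H → H → Prop) (G : H × (Fin (k + 1) → H) → Prop)
    (hR : ∀ q, G q → ∀ ω, R (angle q.1 q.2 ω) (angle q.1 q.2 (Function.update ω 0 (!ω 0))))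
    {δ η α θ : ℝ} (hη : η = δ / (2 * Fintype.card (DCube (k + 1))))
    (hα : α = δ / 2 * η ^ Fintype.card (DCube (k + 1)))
    (hδ : 0 < δ) (hG : δ ≤ pr G) (hθ : 0 < θ) :
    ∃ r : DCube (k + 1) → H,
      α / 2 ≤ pr (fun q => G q ∧ ∀ ω, R (angle q.1 q.2 ω) (r ω)) ∧
      ∀ ω, pr (fun q : H × H => pr (fun a => R q.1 a ∧ R q.2 a) < θ ∧ R q.1 (r ω) ∧ R q.2 (r ω)) ≤
        2 * Fintype.card (DCube (k + 1)) * θ / α := by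
  classical
  set B : ℝ := ((Fintype.card (DCube (k + 1)) : ℕ) : ℝ) with hB
  have hB0 : 0 < B := by rw [hB]; exact_mod_cast Fintype.card_pos
  have hη0 : 0 < η := by rw [hη]; positivity
  have hα0 : 0 < α := by rw [hα]; positivity
  -- cubes of `G` all of whose vertices have high degree
  have h1 : δ / 2 ≤ pr fun q => G q ∧ ∀ ω, η ≤ pr (R (angle q.1 q.2 ω)) := by
    have h2 : pr G ≤ pr (fun q => G q ∧ ∀ ω, η ≤ pr (R (angle q.1 q.2 ω))) +
        pr (fun q : H × (Fin (k + 1) → H) => ∃ ω : DCube (k + 1), pr (R (angle q.1 q.2 ω)) < η ∧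
          R (angle q.1 q.2 ω) (angle q.1 q.2 (Function.update ω 0 (!ω 0)))) := by
      refine le_trans (pr_mono fun q hq => ?_) (pr_or_le _ _)
      by_cases h : ∀ ω, η ≤ pr (R (angle q.1 q.2 ω))
      · exact Or.inl ⟨hq, h⟩
      · push Not at h
        obtain ⟨ω, hω⟩ := h
        exact Or.inr ⟨ω, hω, hR q hq ω⟩
    have h3 := (pr_exists_le (fun (ω : DCube (k + 1)) (q : H × (Fin (k + 1) → H)) =>
      pr (R (angle q.1 q.2 ω)) < η ∧
        R (angle q.1 q.2 ω) (angle q.1 q.2 (Function.update ω 0 (!ω 0))))).trans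
      (sum_le_sum fun ω _ => pr_low_degree_le R ω 0 hη0.le)
    rw [sum_const, card_univ, nsmul_eq_mul, ← hB] at h3
    have h4 : B * η = δ / 2 := by rw [hη]; field_simp
    linarith
  have h2 : α ≤ 𝔼 r : DCube (k + 1) → H,
      pr (fun q => G q ∧ ∀ ω, R (angle q.1 q.2 ω) (r ω)) := by
    rw [← pr_prod' (fun p : (H × (Fin (k + 1) → H)) × (DCube (k + 1) → H) =>
      G p.1 ∧ ∀ ω, R (angle p.1.1 p.1.2 ω) (p.2 ω)), hα]
    refine mul_le_pr_prod _ _ (by positivity) h1 fun q hq => ?_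
    simp only [hq.1, true_and]
    rw [pr_pi_forall (fun ω => R (angle q.1 q.2 ω)), ← card_univ, ← prod_const]
    exact prod_le_prod (fun _ _ => hη0.le) fun ω _ => hq.2 ω
  have h3 : 𝔼 r : DCube (k + 1) → H, (∑ ω, pr (fun q : H × H =>
      pr (fun a => R q.1 a ∧ R q.2 a) < θ ∧ R q.1 (r ω) ∧ R q.2 (r ω))) ≤ B * θ := by
    rw [expect_sum_comm, hB, ← nsmul_eq_mul, ← card_univ, ← sum_const]
    refine sum_le_sum fun ω _ => ?_
    rw [← pr_prod' (fun p : (H × H) × (DCube (k + 1) → H) =>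
      pr (fun a => R p.1.1 a ∧ R p.1.2 a) < θ ∧ R p.1.1 (p.2 ω) ∧ R p.1.2 (p.2 ω)), pr_prod]
    refine expect_le univ_nonempty fun q _ => ?_
    by_cases hq : pr (fun a => R q.1 a ∧ R q.2 a) < θ
    · simp only [hq, true_and]
      exact (pr_pi_eval ω (fun a => R q.1 a ∧ R q.2 a)).le.trans hq.le
    · simpa [hq, pr_false] using hθ.le
  have h4 : α / 2 ≤ 𝔼 r : DCube (k + 1) → H,
      (pr (fun q => G q ∧ ∀ ω, R (angle q.1 q.2 ω) (r ω)) -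
        α / (2 * B * θ) * ∑ ω, pr (fun q : H × H =>
          pr (fun a => R q.1 a ∧ R q.2 a) < θ ∧ R q.1 (r ω) ∧ R q.2 (r ω))) := by
    rw [expect_sub_distrib, ← mul_expect]
    have h5 := mul_le_mul_of_nonneg_left h3 (by positivity : 0 ≤ α / (2 * B * θ))
    have h6 : α / (2 * B * θ) * (B * θ) = α / 2 := by field_simp
    linarith
  obtain ⟨r, -, hr⟩ := exists_le_of_le_expect univ_nonempty h4
  refine ⟨r, ?_, fun ω => ?_⟩
  · refine hr.trans (sub_le_self _ ?_)
    exact mul_nonneg (by positivity) (sum_nonneg fun ω _ => pr_nonneg _)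
  · have h5 := single_le_sum (f := fun ω => pr (fun q : H × H =>
      pr (fun a => R q.1 a ∧ R q.2 a) < θ ∧ R q.1 (r ω) ∧ R q.2 (r ω)))
      (fun ω _ => pr_nonneg _) (mem_univ ω)
    have h6 := pr_le_one (fun q => G q ∧ ∀ ω, R (angle q.1 q.2 ω) (r ω))
    refine h5.trans ?_
    set S := ∑ ω, pr (fun q : H × H =>
      pr (fun a => R q.1 a ∧ R q.2 a) < θ ∧ R q.1 (r ω) ∧ R q.2 (r ω))
    have h7 : α / (2 * B * θ) * S ≤ 1 := by linarith
    calc S = (2 * B * θ / α) * (α / (2 * B * θ) * S) := by field_simp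
      _ ≤ (2 * B * θ / α) * 1 := mul_le_mul_of_nonneg_left h7 (by positivity)
      _ = _ := mul_one _

/-- A set `Y` that contains many cubes of `G` and any two points of which are joined by many
walks; each walk runs through a common neighbour of an end point and a vertex of a cube of `G`, at
either end. -/
lemma exists_linked_set (k : ℕ) : ∃ C : ℕ, ∀ (H : Type*) [AddCommGroup H] [Fintype H]
    (R : H → H → Prop) (G : H × (Fin (k + 1) → H) → Prop) (δ : ℝ), 0 < δ → δ ≤ 1 / 2 → δ ≤ pr G →
    (∀ q, G q → ∀ ω, R (angle q.1 q.2 ω) (angle q.1 q.2 (Function.update ω 0 (!ω 0)))) →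
    ∃ Y : Set H, δ ^ C ≤ pr (fun q => G q ∧ ∀ ω, angle q.1 q.2 ω ∈ Y) ∧
      ∀ z ∈ Y, ∀ z' ∈ Y, δ ^ C ≤ pr fun u : (H × (Fin (k + 1) → H)) × (H × H) =>
        G u.1 ∧ ∃ ω ω', (R z u.2.1 ∧ R (angle u.1.1 u.1.2 ω) u.2.1) ∧
          (R z' u.2.2 ∧ R (angle u.1.1 u.1.2 ω') u.2.2) := by
  classical
  set B : ℝ := ((Fintype.card (DCube (k + 1)) : ℕ) : ℝ) with hB
  have hB0 : 1 ≤ B := by rw [hB]; exact_mod_cast Fintype.card_pos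
  set b := Fintype.card (DCube (k + 1)) with hb
  -- the two bounds are `c₀ δ ^ (b + 1)` and `c₀ ^ 7 c₁ δ ^ (7 (b + 1))`, up to constants
  set c₀ : ℝ := 1 / 2 * (1 / (2 * B)) ^ b with hc₀
  have hc₀0 : 0 < c₀ := by positivity
  set c₁ : ℝ := (1 / (16 * B)) ^ 2 / (2 * B) with hc₁
  have hc₁0 : 0 < c₁ := by positivity
  obtain ⟨m, hm⟩ := exists_pow_le_mul_pow (c := c₀ / 4) (by positivity) (b + 1)
  obtain ⟨m', hm'⟩ := exists_pow_le_mul_pow (c := c₀ ^ 7 * c₁ ^ 2 / 8) (by positivity) (7 * (b + 1))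
  refine ⟨max m m', ?_⟩
  intro H _ _ R G δ hδ hδ2 hG hR
  set η : ℝ := δ / (2 * B) with hη
  set α : ℝ := δ / 2 * η ^ b with hα
  have hη0 : 0 < η := by positivity
  have hα0 : 0 < α := by positivity
  have hαc : α = c₀ * δ ^ (b + 1) := by rw [hα, hη, hc₀]; simp only [div_pow]; ring
  set κ : ℝ := α / (16 * B) with hκ
  have hκ0 : 0 < κ := by positivity
  have hBκ : B * κ = α / 16 := by rw [hκ]; field_simp
  set θ : ℝ := c₁ * α ^ 3 with hθ
  have hθ0 : 0 < θ := by positivity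
  have hθκ : 2 * B * θ / α = κ ^ 2 := by rw [hθ, hκ, hc₁]; field_simp
  obtain ⟨r, hr1, hr2⟩ := exists_roots R G hR hη hα hδ hG hθ0
  rw [← hb, ← hB, hθκ] at hr2
  set bad : H → H → Prop := fun x y => pr (fun a => R x a ∧ R y a) < θ with hbad
  set P : DCube (k + 1) → H → Prop :=
    fun ω x => R x (r ω) ∧ pr (fun y => bad x y ∧ R y (r ω)) < κ with hP
  have hrem : ∀ ω, pr (fun x => R x (r ω) ∧ ¬ P ω x) ≤ κ := by
    intro ω
    have h1 : 𝔼 x, pr (fun y => bad x y ∧ R x (r ω) ∧ R y (r ω)) ≤ κ ^ 2 := by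
      rw [← pr_prod (fun q : H × H => bad q.1 q.2 ∧ R q.1 (r ω) ∧ R q.2 (r ω))]
      exact hr2 ω
    have h2 := pr_le_div (fun x => pr_nonneg _) hκ0 h1
    have h3 : κ ^ 2 / κ = κ := by field_simp
    rw [h3] at h2
    refine (pr_mono fun x hx => ?_).trans h2
    have h4 : ¬ pr (fun y => bad x y ∧ R y (r ω)) < κ := fun h => hx.2 ⟨hx.1, h⟩
    simpa [hx.1] using h4
  have hcubes : α / 4 ≤ pr fun q => G q ∧ ∀ ω, P ω (angle q.1 q.2 ω) := by
    have h1 : pr (fun q => G q ∧ ∀ ω, R (angle q.1 q.2 ω) (r ω)) ≤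
        pr (fun q => G q ∧ ∀ ω, P ω (angle q.1 q.2 ω)) +
        pr (fun q : H × (Fin (k + 1) → H) => ∃ ω : DCube (k + 1),
          R (angle q.1 q.2 ω) (r ω) ∧ ¬ P ω (angle q.1 q.2 ω)) := by
      refine le_trans (pr_mono fun q hq => ?_) (pr_or_le _ _)
      by_cases h : ∀ ω, P ω (angle q.1 q.2 ω)
      · exact Or.inl ⟨hq.1, h⟩
      · push Not at h
        obtain ⟨ω, hω⟩ := h
        exact Or.inr ⟨ω, hq.2 ω, hω⟩
    have h2 := pr_exists_le (fun (ω : DCube (k + 1)) (q : H × (Fin (k + 1) → H)) =>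
      R (angle q.1 q.2 ω) (r ω) ∧ ¬ P ω (angle q.1 q.2 ω))
    have h3 : ∑ ω : DCube (k + 1), pr (fun q : H × (Fin (k + 1) → H) =>
        R (angle q.1 q.2 ω) (r ω) ∧ ¬ P ω (angle q.1 q.2 ω)) ≤ B * κ := by
      rw [hB, ← nsmul_eq_mul, hb, ← card_univ, ← sum_const]
      refine sum_le_sum fun ω _ => ?_
      rw [pr_vertex ω (fun x => R x (r ω) ∧ ¬ P ω x)]
      exact hrem ω
    linarith
  refine ⟨{x | ∃ ω, P ω x}, ?_, ?_⟩
  · calc δ ^ max m m' ≤ δ ^ m := pow_le_pow_of_le_one hδ.le (by linarith) (le_max_left _ _)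
      _ ≤ c₀ / 4 * δ ^ (b + 1) := hm δ hδ hδ2
      _ = α / 4 := by rw [hαc]; ring
      _ ≤ _ := hcubes
      _ ≤ _ := pr_mono fun q hq => ⟨hq.1, fun ω => ⟨ω, hq.2 ω⟩⟩
  · rintro z ⟨ω, hz⟩ z' ⟨ω', hz'⟩
    have few : ∀ (ω : DCube (k + 1)) (z : H), P ω z → pr (fun q : H × (Fin (k + 1) → H) =>
        bad z (angle q.1 q.2 ω) ∧ R (angle q.1 q.2 ω) (r ω)) ≤ κ := by
      intro ω z hz
      rw [pr_vertex ω (fun y => bad z y ∧ R y (r ω))]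
      exact hz.2.le
    have h1 : α / 8 ≤ pr fun q => G q ∧ ¬ bad z (angle q.1 q.2 ω) ∧
        ¬ bad z' (angle q.1 q.2 ω') := by
      have h2 : pr (fun q => G q ∧ ∀ ω, P ω (angle q.1 q.2 ω)) ≤
          pr (fun q => G q ∧ ¬ bad z (angle q.1 q.2 ω) ∧ ¬ bad z' (angle q.1 q.2 ω')) +
          (pr (fun q : H × (Fin (k + 1) → H) =>
            bad z (angle q.1 q.2 ω) ∧ R (angle q.1 q.2 ω) (r ω)) +
          pr (fun q : H × (Fin (k + 1) → H) =>
            bad z' (angle q.1 q.2 ω') ∧ R (angle q.1 q.2 ω') (r ω'))) := by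
        refine le_trans (pr_mono fun q hq => ?_)
          ((pr_or_le _ _).trans (add_le_add le_rfl (pr_or_le _ _)))
        by_cases h : bad z (angle q.1 q.2 ω)
        · exact Or.inr (Or.inl ⟨h, (hq.2 ω).1⟩)
        · by_cases h' : bad z' (angle q.1 q.2 ω')
          · exact Or.inr (Or.inr ⟨h', (hq.2 ω').1⟩)
          · exact Or.inl ⟨hq.1, h, h'⟩
      have h3 := few ω z hz
      have h4 := few ω' z' hz'
      have h5 : κ ≤ B * κ := le_mul_of_one_le_left hκ0.le hB0
      linarith
    calc δ ^ max m m' ≤ δ ^ m' := pow_le_pow_of_le_one hδ.le (by linarith) (le_max_right _ _)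
      _ ≤ c₀ ^ 7 * c₁ ^ 2 / 8 * δ ^ (7 * (b + 1)) := hm' δ hδ hδ2
      _ = α / 8 * (θ * θ) := by rw [hθ, hαc]; ring
      _ ≤ _ := by
        refine mul_le_pr_prod _ _ (by positivity) h1 fun q hq => ?_
        have h2 : θ ≤ pr fun a => R z a ∧ R (angle q.1 q.2 ω) a := not_lt.1 hq.2.1
        have h3 : θ ≤ pr fun a => R z' a ∧ R (angle q.1 q.2 ω') a := not_lt.1 hq.2.2
        refine (mul_le_mul h2 h3 hθ0.le (pr_nonneg _)).trans ?_
        rw [← pr_prod_and]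
        exact pr_mono fun u hu => ⟨hq.1, ω, ω', hu⟩

end DependentChoice

/-! ### Bounded integer combinations and almost polynomial functions -/

section Combinations

variable {H : Type*}

/-- `a` is an integer combination of the values at `x` of the functions in `F 0, …, F (t - 1)`, the
coefficients at level `r` having absolute sum at most `M ^ (t - r)`. -/
def BddComb (F : ℕ → Finset (H → ℝ)) (t : ℕ) (M : ℝ) (x : H) (a : ℝ) : Prop :=
  ∃ b : ℕ → (H → ℝ) → ℤ, (∀ r < t, ∑ φ ∈ F r, |(b r φ : ℝ)| ≤ M ^ (t - r)) ∧
    a = ∑ i ∈ range t, ∑ φ ∈ F i, (b i φ : ℝ) * φ x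

/-- The identity of the derivatives condition at the single cube `c`. A hierarchy is encoded by the
finite sets `F i` of its functions of level `i`. -/
def DerivAt (F : ℕ → Finset (H → ℝ)) {k : ℕ} (t : ℕ) (M : ℝ) (g : H → ℝ) (c : DCube k → H) : Prop :=
  ∃ a : DCube k → ℝ, (∀ ω, BddComb F t M (c ω) (a ω)) ∧
    cubeDeriv g c = ∑ ω, (-1 : ℝ) ^ weight ω * a ω

lemma sum_abs_ite {F F' : Finset (H → ℝ)} [DecidablePred (· ∈ F)] (h : F ⊆ F')
    (b : (H → ℝ) → ℤ) :
    ∑ φ ∈ F', |((if φ ∈ F then b φ else 0 : ℤ) : ℝ)| = ∑ φ ∈ F, |(b φ : ℝ)| := by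
  rw [← sum_subset h]
  · exact sum_congr rfl fun φ hφ => by simp [hφ]
  · intro φ _ hφ; simp [hφ]

lemma sum_ite_mul {F F' : Finset (H → ℝ)} [DecidablePred (· ∈ F)] (h : F ⊆ F')
    (b : (H → ℝ) → ℤ) (x : H) :
    ∑ φ ∈ F', ((if φ ∈ F then b φ else 0 : ℤ) : ℝ) * φ x = ∑ φ ∈ F, (b φ : ℝ) * φ x := by
  rw [← sum_subset h]
  · exact sum_congr rfl fun φ hφ => by simp [hφ]
  · intro φ _ hφ; simp [hφ]

lemma BddComb.mono {F F' : ℕ → Finset (H → ℝ)} {t : ℕ} {M M' : ℝ} {x : H} {a : ℝ}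
    (h : BddComb F t M x a) (hF : ∀ i < t, F i ⊆ F' i) (hM0 : 0 ≤ M) (hM : M ≤ M') :
    BddComb F' t M' x a := by
  classical
  obtain ⟨b, hb, rfl⟩ := h
  refine ⟨fun r φ => if φ ∈ F r then b r φ else 0, fun r hr => ?_, ?_⟩
  · rw [sum_abs_ite (hF r hr)]
    exact (hb r hr).trans (pow_le_pow_left₀ hM0 hM _)
  · refine sum_congr rfl fun i hi => ?_
    rw [sum_ite_mul (hF i (mem_range.1 hi))]

lemma DerivAt.mono {F F' : ℕ → Finset (H → ℝ)} {k t : ℕ} {M M' : ℝ} {g : H → ℝ} {c : DCube k → H}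
    (h : DerivAt F t M g c) (hF : ∀ i < t, F i ⊆ F' i) (hM0 : 0 ≤ M) (hM : M ≤ M') :
    DerivAt F' t M' g c := by
  obtain ⟨a, ha, he⟩ := h
  exact ⟨a, fun ω => (ha ω).mono hF hM0 hM, he⟩

/-- `a` is an integer combination of the values at `x` of the functions in `F`, with coefficients of
absolute sum at most `L`. -/
def LevelComb (F : Finset (H → ℝ)) (L : ℝ) (x : H) (a : ℝ) : Prop :=
  ∃ b : (H → ℝ) → ℤ, ∑ φ ∈ F, |(b φ : ℝ)| ≤ L ∧ a = ∑ φ ∈ F, (b φ : ℝ) * φ x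

lemma LevelComb.zero (F : Finset (H → ℝ)) (x : H) : LevelComb F 0 x 0 :=
  ⟨fun _ => 0, by simp, by simp⟩

lemma LevelComb.single {F : Finset (H → ℝ)} {φ : H → ℝ} (hφ : φ ∈ F) (x : H) :
    LevelComb F 1 x (φ x) := by
  classical
  refine ⟨fun ψ => if ψ = φ then 1 else 0, ?_, ?_⟩
  · rw [sum_eq_single φ]
    · simp
    · intro ψ _ hψ; simp [hψ]
    · exact fun h => absurd hφ h
  · rw [sum_eq_single φ]
    · simp
    · intro ψ _ hψ; simp [hψ]
    · exact fun h => absurd hφ h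

lemma LevelComb.add {F : Finset (H → ℝ)} {L L' : ℝ} {x : H} {a a' : ℝ}
    (h : LevelComb F L x a) (h' : LevelComb F L' x a') : LevelComb F (L + L') x (a + a') := by
  obtain ⟨b, hb, rfl⟩ := h
  obtain ⟨b', hb', rfl⟩ := h'
  refine ⟨fun φ => b φ + b' φ, ?_, ?_⟩
  · refine le_trans ?_ (add_le_add hb hb')
    rw [← sum_add_distrib]
    refine sum_le_sum fun φ _ => ?_
    push_cast
    exact abs_add_le _ _
  · rw [← sum_add_distrib]
    refine sum_congr rfl fun φ _ => ?_
    push_cast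
    ring

lemma LevelComb.neg {F : Finset (H → ℝ)} {L : ℝ} {x : H} {a : ℝ}
    (h : LevelComb F L x a) : LevelComb F L x (-a) := by
  obtain ⟨b, hb, rfl⟩ := h
  refine ⟨fun φ => - b φ, ?_, ?_⟩
  · simpa using hb
  · simp

lemma LevelComb.mono {F : Finset (H → ℝ)} {L L' : ℝ} {x : H} {a : ℝ}
    (h : LevelComb F L x a) (hL : L ≤ L') : LevelComb F L' x a := by
  obtain ⟨b, hb, rfl⟩ := h
  exact ⟨b, hb.trans hL, rfl⟩

lemma LevelComb.bddComb {F : ℕ → Finset (H → ℝ)} {s : ℕ} {M : ℝ} {x : H} {a : ℝ}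
    (h : LevelComb (F s) M x a) (hM : 0 ≤ M) : BddComb F (s + 1) M x a := by
  obtain ⟨b, hb, rfl⟩ := h
  refine ⟨fun r φ => if r = s then b φ else 0, fun r hr => ?_, ?_⟩
  · by_cases h : r = s
    · subst h; simpa using hb
    · simpa [h] using pow_nonneg hM _
  · rw [sum_eq_single s]
    · simp
    · intro i _ hi; simp [hi]
    · intro h; simp at h

lemma derivAt_zero {k t : ℕ} {M : ℝ} (hM : 0 ≤ M) (F : ℕ → Finset (H → ℝ)) (c : DCube k → H) :
    DerivAt F t M (fun _ => 0) c := by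
  refine ⟨fun _ => 0, fun ω => ⟨fun _ _ => 0, fun r _ => ?_, ?_⟩, ?_⟩
  · simpa using pow_nonneg hM _
  · simp
  · simp [cubeDeriv]

end Combinations

section Translates

variable {H : Type*} [AddCommGroup H]

/-- The translate `x ↦ φ (x + w)`. -/
def translate (w : H) (φ : H → ℝ) : H → ℝ := fun x => φ (x + w)

lemma translate_injective (w : H) : Function.Injective (translate w) := by
  intro φ ψ h
  funext x
  simpa [translate] using congrFun h (x - w)

/-- The set of translates of the functions of a finite set. -/
noncomputable def translateSet (w : H) (F : Finset (H → ℝ)) : Finset (H → ℝ) :=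
  F.map ⟨translate w, translate_injective w⟩

lemma bddComb_translate {F : ℕ → Finset (H → ℝ)} {t : ℕ} {M : ℝ} {x : H} {a : ℝ} (w : H)
    (h : BddComb F t M (x + w) a) : BddComb (fun i => translateSet w (F i)) t M x a := by
  classical
  obtain ⟨b, hb, rfl⟩ := h
  have hinv : ∀ φ : H → ℝ, translate (-w) (translate w φ) = φ := by
    intro φ; funext x; simp [translate]
  refine ⟨fun r φ => b r (translate (-w) φ), fun r hr => ?_, ?_⟩
  · simp only [translateSet, sum_map]
    simpa [hinv] using hb r hr
  · refine sum_congr rfl fun i _ => ?_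
    simp only [translateSet, sum_map]
    refine sum_congr rfl fun φ _ => ?_
    simp [hinv, translate]

lemma angle_add_base {k : ℕ} (x w : H) (h : Fin k → H) (ω : DCube k) :
    angle (x + w) h ω = angle x h ω + w := by
  unfold angle; abel

lemma derivAt_translate {F : ℕ → Finset (H → ℝ)} {k t : ℕ} {M : ℝ} {g : H → ℝ} {x w : H}
    {h : Fin k → H} (hd : DerivAt F t M g (angle (x + w) h)) :
    DerivAt (fun i => translateSet w (F i)) t M (translate w g) (angle x h) := by
  obtain ⟨a, ha, he⟩ := hd
  refine ⟨a, fun ω => ?_, ?_⟩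
  · exact bddComb_translate w (by simpa [angle_add_base] using ha ω)
  · rw [← he]
    simp [cubeDeriv, translate, angle_add_base]

end Translates

section Approximation

variable {H : Type*} [AddCommGroup H] [Fintype H]

/-- The finite sets `F 0, …, F (s - 1)` form a polynomial hierarchy, and `q` obeys the derivatives
condition of degree `s` relative to it, with all bounds equal to `K` and for all cubes of each
dimension up to a proportion `ε`. -/
structure IsAlmostPoly (s : ℕ) (ε K : ℝ) (F : ℕ → Finset (H → ℝ)) (q : H → ℝ) : Prop where
  one_le : 1 ≤ K
  card_le : ∀ i < s, ((F i).card : ℝ) ≤ K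
  level : ∀ i < s, pr (fun p : H × (Fin (i + 1) → H) =>
    ¬ ∀ φ ∈ F i, DerivAt F i K φ (angle p.1 p.2)) ≤ ε
  top : pr (fun p : H × (Fin (s + 1) → H) => ¬ DerivAt F s K q (angle p.1 p.2)) ≤ ε

lemma isAlmostPoly_zero (s : ℕ) {ε K : ℝ} (hε : 0 ≤ ε) (hK : 1 ≤ K) :
    IsAlmostPoly s ε K (fun _ => (∅ : Finset (H → ℝ))) (fun _ => 0) := by
  refine ⟨hK, fun i _ => ?_, fun i _ => ?_, ?_⟩
  · simpa using zero_le_one.trans hK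
  · simpa [pr_false] using hε
  · simpa [derivAt_zero (zero_le_one.trans hK), pr_false] using hε

end Approximation

/-! ### Slices of a set of cubes -/

/-- The inverse theorem for degree `s`, with exceptional sets of cubes in place of a system of
cubes: a function whose derivative vanishes on a set `G` of cubes of probability `δ` agrees, on a
set containing many cubes of `G`, with a function that has a polynomial hierarchy on almost all
cubes. The lower bound for the number of cubes does not involve `ε`. -/
def InverseStatement (s : ℕ) : Prop :=
  ∃ C : ℕ, ∀ (H : Type u) [AddCommGroup H] [Fintype H] (g : H → ℝ)
    (G : H × (Fin (s + 1) → H) → Prop) (δ ε : ℝ), 0 < δ → δ ≤ 1 / 2 → 0 < ε → ε ≤ 1 / 2 →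
    (∀ p, G p → cubeDeriv g (angle p.1 p.2) = 0) → δ ≤ pr G →
    ∃ (F : ℕ → Finset (H → ℝ)) (q : H → ℝ) (Y : Set H),
      IsAlmostPoly s ε ((ε * δ) ^ C)⁻¹ F q ∧ (∀ y ∈ Y, g y = q y) ∧
      δ ^ C ≤ pr fun p => G p ∧ ∀ ω, angle p.1 p.2 ω ∈ Y

lemma IsAlmostPoly.mono {H : Type*} [AddCommGroup H] [Fintype H] {s : ℕ} {ε ε' K K' : ℝ}
    {F : ℕ → Finset (H → ℝ)} {q : H → ℝ} (h : IsAlmostPoly s ε K F q) (hε : ε ≤ ε')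
    (hK : K ≤ K') : IsAlmostPoly s ε' K' F q := by
  have h0 : 0 ≤ K := zero_le_one.trans h.one_le
  refine ⟨h.one_le.trans hK, fun i hi => (h.card_le i hi).trans hK, fun i hi => ?_, ?_⟩
  · refine (pr_mono fun p hp hp' => hp fun φ hφ => ?_).trans ((h.level i hi).trans hε)
    exact (hp' φ hφ).mono (fun _ _ => Subset.rfl) h0 hK
  · refine (pr_mono fun p hp hp' => hp ?_).trans (h.top.trans hε)
    exact hp'.mono (fun _ _ => Subset.rfl) h0 hK

section Slices

variable {H : Type u} [AddCommGroup H]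

lemma angle_insertNth {k : ℕ} (i : Fin (k + 1)) (x y : H) (h : Fin k → H) (ω : DCube (k + 1)) :
    angle x (i.insertNth y h : Fin (k + 1) → H) ω =
      angle x h (i.removeNth ω) + if ω i = true then y else 0 := by
  unfold angle
  rw [Fin.sum_univ_succAbove _ i]
  simp only [Fin.insertNth_apply_same, Fin.insertNth_apply_succAbove, Fin.removeNth]
  abel

lemma weight_insertNth {k : ℕ} (i : Fin (k + 1)) (b : Bool) (ω : DCube k) :
    weight (i.insertNth b ω : DCube (k + 1)) = (if b = true then 1 else 0) + weight ω := by
  unfold weight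
  simp only [card_filter]
  rw [Fin.sum_univ_succAbove _ i]
  simp

lemma cubeDeriv_insertNth {k : ℕ} (i : Fin (k + 1)) (x y : H) (h : Fin k → H) (g : H → ℝ) :
    cubeDeriv g (angle x (i.insertNth y h : Fin (k + 1) → H)) =
      cubeDeriv (fun z => g z - g (z + y)) (angle x h) := by
  unfold cubeDeriv
  rw [← (Fin.insertNthEquiv (fun _ => Bool) i).sum_comp, Fintype.sum_prod_type,
    Fintype.sum_bool, ← sum_add_distrib]
  refine sum_congr rfl fun ω _ => ?_
  have hw : ∀ b, weight (Fin.insertNthEquiv (fun _ => Bool) i (b, ω) : DCube (k + 1)) =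
      (if b = true then 1 else 0) + weight ω := fun b => weight_insertNth i b ω
  have ha : ∀ b, angle x (i.insertNth y h : Fin (k + 1) → H)
      (Fin.insertNthEquiv (fun _ => Bool) i (b, ω)) = angle x h ω + if b = true then y else 0 := by
    intro b
    have h1 := angle_insertNth i x y h (i.insertNth b ω)
    rwa [Fin.removeNth_insertNth, Fin.insertNth_apply_same] at h1
  simp only [hw, ha, if_true, Bool.false_eq_true, if_false, add_zero, zero_add, pow_add, pow_one]
  ring

lemma pr_insertNth {H : Type*} [Fintype H] {k : ℕ} (i : Fin (k + 1)) (p : H × (Fin (k + 1) → H) → Prop) :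
    pr p = pr fun u : H × (H × (Fin k → H)) => p (u.2.1, i.insertNth u.1 u.2.2) := by
  let e : H × (H × (Fin k → H)) ≃ H × (Fin (k + 1) → H) :=
    { toFun := fun u => (u.2.1, i.insertNth u.1 u.2.2)
      invFun := fun v => (v.2 i, (v.1, i.removeNth v.2))
      left_inv := fun u => by simp
      right_inv := fun v => by simp }
  exact (pr_equiv e p).symm

variable [Fintype H]

/-- The derivatives `x ↦ g x - g (x + y)` along the `i`-th sides `y` of the cubes in `G` can be
replaced by functions with hierarchies, at the expense of passing to fewer cubes. -/
lemma exists_slices {s C : ℕ}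
    (hC : ∀ (g : H → ℝ) (G : H × (Fin (s + 1) → H) → Prop) (δ ε : ℝ), 0 < δ → δ ≤ 1 / 2 → 0 < ε →
      ε ≤ 1 / 2 → (∀ p, G p → cubeDeriv g (angle p.1 p.2) = 0) → δ ≤ pr G →
      ∃ (F : ℕ → Finset (H → ℝ)) (q : H → ℝ) (Y : Set H),
        IsAlmostPoly s ε ((ε * δ) ^ C)⁻¹ F q ∧ (∀ y ∈ Y, g y = q y) ∧
        δ ^ C ≤ pr fun p => G p ∧ ∀ ω, angle p.1 p.2 ω ∈ Y)
    (i : Fin (s + 2)) (g : H → ℝ) (G : H × (Fin (s + 2) → H) → Prop) {δ ε : ℝ} (hδ : 0 < δ)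
    (hδ2 : δ ≤ 1 / 2) (hε : 0 < ε) (hε2 : ε ≤ 1 / 2)
    (hg : ∀ p, G p → cubeDeriv g (angle p.1 p.2) = 0) (hG : δ ≤ pr G) :
    ∃ (F : H → ℕ → Finset (H → ℝ)) (q : H → H → ℝ) (G' : H × (Fin (s + 2) → H) → Prop),
      (∀ p, G' p → G p) ∧ δ ^ (2 * C + 2) ≤ pr G' ∧
      (∀ y, IsAlmostPoly s ε ((ε * δ ^ 2) ^ C)⁻¹ (F y) (q y)) ∧
      ∀ p, G' p → ∀ ω, ω i = false →
        g (angle p.1 p.2 ω) - g (angle p.1 p.2 ω + p.2 i) = q (p.2 i) (angle p.1 p.2 ω) := by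
  have hδ4 : δ ^ 2 ≤ δ / 2 := by nlinarith
  have hK : 1 ≤ ((ε * δ ^ 2) ^ C)⁻¹ :=
    (one_le_inv₀ (by positivity)).2 (pow_le_one₀ (by positivity) (by nlinarith))
  have key : ∀ y : H, ∃ (F : ℕ → Finset (H → ℝ)) (q : H → ℝ) (Y : Set H),
      IsAlmostPoly s ε ((ε * δ ^ 2) ^ C)⁻¹ F q ∧ (∀ z ∈ Y, g z - g (z + y) = q z) ∧
      (δ / 2 ≤ pr (fun p : H × (Fin (s + 1) → H) => G (p.1, i.insertNth y p.2)) → (δ ^ 2) ^ C ≤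
        pr fun p : H × (Fin (s + 1) → H) =>
          G (p.1, i.insertNth y p.2) ∧ ∀ ω, angle p.1 p.2 ω ∈ Y) := by
    intro y
    by_cases hy : δ / 2 ≤ pr (fun p : H × (Fin (s + 1) → H) => G (p.1, i.insertNth y p.2))
    · obtain ⟨F, q, Y, h1, h2, h3⟩ := hC (fun z => g z - g (z + y))
        (fun p => G (p.1, i.insertNth y p.2)) (δ ^ 2) ε (by positivity) (by nlinarith) hε hε2
        (fun p hp => by rw [← cubeDeriv_insertNth i]; exact hg _ hp) (hδ4.trans hy)
      exact ⟨F, q, Y, h1, h2, fun _ => h3⟩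
    · exact ⟨fun _ => ∅, fun _ => 0, ∅, isAlmostPoly_zero s hε.le hK, by simp,
        fun h => absurd h hy⟩
  choose F q Y h1 h2 h3 using key
  refine ⟨F, q, fun p => G p ∧ ∀ ω, angle p.1 (i.removeNth p.2) ω ∈ Y (p.2 i), fun p hp => hp.1,
    ?_, h1, ?_⟩
  · have h4 := half_le_pr_fiber _ hδ.le (hG.trans (pr_insertNth i G).le)
    rw [pr_insertNth i]
    calc δ ^ (2 * C + 2) = δ ^ 2 * (δ ^ 2) ^ C := by rw [← pow_mul, pow_add]; ring
      _ ≤ δ / 2 * (δ ^ 2) ^ C := mul_le_mul_of_nonneg_right hδ4 (by positivity)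
      _ ≤ _ := by
        refine mul_le_pr_prod _ _ (by positivity) h4 fun y hy => (h3 y hy).trans ?_
        exact pr_mono fun p hp => by simpa using hp
  · intro p hp ω hω
    refine h2 _ _ ?_
    have h4 := angle_insertNth i p.1 (p.2 i) (i.removeNth p.2) ω
    rw [Fin.insertNth_self_removeNth, hω] at h4
    rw [h4]
    simpa using hp.2 (i.removeNth ω)

end Slices

/-- Many cubes of `G` have all their edges governed by functions with hierarchies of smaller degree,
which depend only on the direction of the edge. -/
lemma InverseStatement.exists_edges {s : ℕ} (h : InverseStatement.{u} s) : ∃ A : ℕ, 1 ≤ A ∧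
    ∀ (H : Type u) [AddCommGroup H] [Fintype H] (g : H → ℝ)
    (G : H × (Fin (s + 2) → H) → Prop) (δ ε : ℝ), 0 < δ → δ ≤ 1 / 2 → 0 < ε → ε ≤ 1 / 2 →
    (∀ p, G p → cubeDeriv g (angle p.1 p.2) = 0) → δ ≤ pr G →
    ∃ (F : Fin (s + 2) → H → ℕ → Finset (H → ℝ)) (q : Fin (s + 2) → H → H → ℝ)
      (G' : H × (Fin (s + 2) → H) → Prop),
      (∀ p, G' p → G p) ∧ δ ^ A ≤ pr G' ∧
      (∀ i y, IsAlmostPoly s ε ((ε * δ) ^ A)⁻¹ (F i y) (q i y)) ∧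
      ∀ p, G' p → ∀ i ω, ω i = false →
        g (angle p.1 p.2 ω) - g (angle p.1 p.2 ω + p.2 i) = q i (p.2 i) (angle p.1 p.2 ω) := by
  classical
  obtain ⟨C, hC⟩ := h
  suffices hT : ∀ T : Finset (Fin (s + 2)), ∃ A : ℕ, 1 ≤ A ∧
      ∀ (H : Type u) [AddCommGroup H] [Fintype H] (g : H → ℝ)
      (G : H × (Fin (s + 2) → H) → Prop) (δ ε : ℝ), 0 < δ → δ ≤ 1 / 2 → 0 < ε → ε ≤ 1 / 2 →
      (∀ p, G p → cubeDeriv g (angle p.1 p.2) = 0) → δ ≤ pr G →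
      ∃ (F : Fin (s + 2) → H → ℕ → Finset (H → ℝ)) (q : Fin (s + 2) → H → H → ℝ)
        (G' : H × (Fin (s + 2) → H) → Prop),
        (∀ p, G' p → G p) ∧ δ ^ A ≤ pr G' ∧
        (∀ i y, IsAlmostPoly s ε ((ε * δ) ^ A)⁻¹ (F i y) (q i y)) ∧
        ∀ p, G' p → ∀ i ∈ T, ∀ ω, ω i = false →
          g (angle p.1 p.2 ω) - g (angle p.1 p.2 ω + p.2 i) =
            q i (p.2 i) (angle p.1 p.2 ω) by
    simpa using hT univ
  intro T
  induction T using Finset.induction_on with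
  | empty =>
    refine ⟨1, le_rfl, ?_⟩
    intro H _ _ g G δ ε hδ hδ2 hε hε2 hg hG
    refine ⟨fun _ _ _ => ∅, fun _ _ _ => 0, G, fun _ h => h, by simpa using hG, fun _ _ => ?_,
      by simp⟩
    exact isAlmostPoly_zero s hε.le
      ((one_le_inv₀ (by positivity)).2 (pow_le_one₀ (by positivity) (by nlinarith)))
  | insert i T _ ih =>
    obtain ⟨A, hA, ih⟩ := ih
    refine ⟨A * (2 * C + 2), by nlinarith, ?_⟩
    intro H _ _ g G δ ε hδ hδ2 hε hε2 hg hG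
    obtain ⟨F, q, G₁, h1, h2, h3, h4⟩ := ih H g G δ ε hδ hδ2 hε hε2 hg hG
    obtain ⟨F', q', G₂, k1, k2, k3, k4⟩ := exists_slices (hC H) i g G₁ (pow_pos hδ A)
      ((pow_le_of_le_one hδ.le (by linarith) (by omega)).trans hδ2) hε hε2
      (fun p hp => hg p (h1 p hp)) h2
    have hεδ : ε * δ ≤ 1 := by nlinarith
    refine ⟨fun j => if j = i then F' else F j, fun j => if j = i then q' else q j, G₂,
      fun p hp => h1 p (k1 p hp), by rwa [pow_mul], fun j y => ?_, ?_⟩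
    · by_cases hj : j = i
      · simp only [hj, if_true]
        refine (k3 y).mono le_rfl (inv_anti₀ (by positivity) ?_)
        calc (ε * δ) ^ (A * (2 * C + 2)) ≤ (ε * δ) ^ (A * 2 * C) :=
              pow_le_pow_of_le_one (by positivity) hεδ (by nlinarith)
          _ = ((ε ^ (A * 2)) * (δ ^ A) ^ 2) ^ C := by rw [pow_mul, mul_pow, pow_mul δ]
          _ ≤ _ := by
            refine pow_le_pow_left₀ (by positivity) ?_ C
            exact mul_le_mul_of_nonneg_right
              (pow_le_of_le_one hε.le (by linarith) (by omega)) (by positivity)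
      · simp only [hj, if_false]
        refine (h3 j y).mono le_rfl (inv_anti₀ (by positivity) ?_)
        exact pow_le_pow_of_le_one (by positivity) hεδ (by nlinarith)
    · intro p hp j hj ω hω
      by_cases hji : j = i
      · subst hji
        simpa using k4 p hp ω hω
      · simp only [hji, if_false]
        exact h4 p (k1 p hp) j ((mem_insert.1 hj).resolve_left hji) ω hω

/-! ### Degree zero, and walks along edges -/

section Constant

variable {H : Type*} [AddCommGroup H]

lemma cubeDeriv_dim_zero (f : H → ℝ) (x : H) (h : Fin 0 → H) : cubeDeriv f (angle x h) = f x := by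
  simp [cubeDeriv, weight, angle]

lemma cubeDeriv_dim_one (f : H → ℝ) (x : H) (h : Fin 1 → H) :
    cubeDeriv f (angle x h) = f x - f (x + h 0) := by
  have h1 := cubeDeriv_insertNth 0 x (h 0) ((0 : Fin 1).removeNth h) f
  rwa [Fin.insertNth_self_removeNth, cubeDeriv_dim_zero] at h1

/-- In degree zero, the function agrees with one of its values on many of the given edges. -/
lemma inverseStatement_zero : InverseStatement.{u} 0 := by
  classical
  refine ⟨2, ?_⟩
  intro H _ _ g G δ ε hδ hδ2 hε hε2 hg hG
  have hedge : ∀ p, G p → g (p.1 + p.2 0) = g p.1 := fun p hp => by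
    have := hg p hp
    rw [cubeDeriv_dim_one] at this
    linarith
  set γ : H → ℝ := fun x => pr fun h => G (x, h) with hγ
  have hγ0 : δ ≤ 𝔼 x, γ x := by rwa [hγ, ← pr_prod]
  have h1 : ∀ x, γ x ≤ pr fun y => g x = g y := by
    intro x
    calc γ x ≤ pr fun h : Fin 1 → H => g (x + h 0) = g x := pr_mono fun h hh => hedge _ hh
      _ = pr fun y => g (x + y) = g x := pr_pi_eval (0 : Fin 1) (fun y => g (x + y) = g x)
      _ = pr fun y => g y = g x := pr_equiv (Equiv.addLeft x) fun y => g y = g x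
      _ = _ := pr_congr fun y => eq_comm
  -- for random `y`, the expected proportion of edges with value `g y` is at least the second moment
  -- of the fibre sizes `γ`
  have h2 : δ ^ 2 ≤ 𝔼 y, pr fun p : H × (Fin 1 → H) => G p ∧ g p.1 = g y := by
    rw [← pr_prod' (fun u : (H × (Fin 1 → H)) × H => G u.1 ∧ g u.1.1 = g u.2), pr_prod]
    have h3 : ∀ p : H × (Fin 1 → H), pr (fun y => G p ∧ g p.1 = g y) =
        if G p then pr (fun y => g p.1 = g y) else 0 := by
      intro p
      by_cases hp : G p <;> simp [hp, pr_false]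
    simp only [h3]
    rw [← univ_product_univ, expect_product]
    have h4 : ∀ x, 2 * δ * γ x - δ ^ 2 ≤
        𝔼 h : Fin 1 → H, if G (x, h) then pr (fun y => g x = g y) else 0 := by
      intro x
      have h5 : (𝔼 h : Fin 1 → H, if G (x, h) then pr (fun y => g x = g y) else 0) =
          γ x * pr fun y => g x = g y := by
        rw [hγ]
        simp only [pr_def (fun h => G (x, h))]
        rw [expect_mul]
        exact expect_congr rfl fun h _ => by split_ifs <;> simp
      rw [h5]
      have h6 := mul_le_mul_of_nonneg_left (h1 x) (pr_nonneg fun h => G (x, h))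
      have h7 : γ x * γ x ≤ γ x * pr fun y => g x = g y := h6
      nlinarith [sq_nonneg (γ x - δ)]
    refine le_trans ?_ (expect_le_expect fun x _ => h4 x)
    rw [expect_sub_distrib, ← mul_expect, Fintype.expect_const]
    nlinarith
  obtain ⟨y, -, hy⟩ := exists_le_of_le_expect univ_nonempty h2
  have hK : 1 ≤ ((ε * δ) ^ 2)⁻¹ :=
    (one_le_inv₀ (by positivity)).2 (pow_le_one₀ (by positivity) (by nlinarith))
  refine ⟨fun _ => ∅, fun _ => g y, {x | g x = g y}, ⟨hK, by simp, by simp, ?_⟩, fun x hx => hx,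
    hy.trans (pr_mono ?_)⟩
  · have h3 : ∀ p : H × (Fin 1 → H),
        DerivAt (fun _ => ∅) 0 ((ε * δ) ^ 2)⁻¹ (fun _ => g y) (angle p.1 p.2) := by
      intro p
      refine ⟨fun _ => 0, fun ω => ⟨fun _ _ => 0, by simp, by simp⟩, ?_⟩
      rw [cubeDeriv_dim_one]
      simp
    simpa [h3, pr_false] using hε.le
  · rintro p ⟨hp, hpy⟩
    refine ⟨hp, fun ω => ?_⟩
    have h3 : angle p.1 p.2 ω = p.1 + if ω 0 = true then p.2 0 else 0 := by simp [angle]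
    change g (angle p.1 p.2 ω) = g y
    rw [h3]
    split_ifs
    · rw [hedge p hp, hpy]
    · rw [add_zero, hpy]

end Constant

section Paths

variable {H : Type*} [AddCommGroup H]

/-- The translates by `w` of the functions `q i (w' - w)`, where `w` and `w'` range over `W`. -/
noncomputable def differenceSet {k : ℕ} (q : Fin k → H → H → ℝ) (W : Finset H) :
    Finset (H → ℝ) := by
  classical
  exact (univ ×ˢ W ×ˢ W).image fun v : Fin k × H × H =>
    translate v.2.1 (q v.1 (v.2.2 - v.2.1))

lemma mem_differenceSet {k : ℕ} {q : Fin k → H → H → ℝ} {W : Finset H} {φ : H → ℝ} :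
    φ ∈ differenceSet q W ↔ ∃ i, ∃ w ∈ W, ∃ w' ∈ W, φ = translate w (q i (w' - w)) := by
  classical
  simp only [differenceSet, mem_image, mem_product, mem_univ, true_and, Prod.exists]
  constructor
  · rintro ⟨i, w, w', ⟨hw, hw'⟩, rfl⟩
    exact ⟨i, w, hw, w', hw', rfl⟩
  · rintro ⟨i, w, hw, w', hw', rfl⟩
    exact ⟨i, w, w', ⟨hw, hw'⟩, rfl⟩

lemma card_differenceSet_le {k : ℕ} (q : Fin k → H → H → ℝ) (W : Finset H) :
    (differenceSet q W).card ≤ k * W.card ^ 2 := by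
  classical
  refine card_image_le.trans ?_
  simp [card_product, sq]

/-- The points `z` and `z'` are joined when the difference of the values of `g` is given by one of
the functions `q i`, read in one of the two directions. -/
def EdgeRel {k : ℕ} (g : H → ℝ) (q : Fin k → H → H → ℝ) (z z' : H) : Prop :=
  ∃ i, g z - g z' = q i (z' - z) z ∨ g z' - g z = q i (z - z') z'

lemma EdgeRel.levelComb {k : ℕ} {g : H → ℝ} {q : Fin k → H → H → ℝ} {W : Finset H} {x w w' : H}
    (hw : w ∈ W) (hw' : w' ∈ W) (h : EdgeRel g q (x + w) (x + w')) :
    LevelComb (differenceSet q W) 1 x (g (x + w) - g (x + w')) := by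
  obtain ⟨i, h | h⟩ := h
  · have h1 := LevelComb.single ((mem_differenceSet (q := q) (W := W)).2 ⟨i, w, hw, w', hw', rfl⟩) x
    rw [h]
    simpa [translate] using h1
  · have h1 := (LevelComb.single ((mem_differenceSet (q := q) (W := W)).2 ⟨i, w', hw', w, hw, rfl⟩) x).neg
    rw [← neg_sub, h]
    simpa [translate] using h1

/-- The values at two vertices of a cube all of whose edges are governed by `q` differ by a bounded
combination of the functions attached to the edges. -/
lemma levelComb_of_edges {k : ℕ} {g : H → ℝ} {q : Fin k → H → H → ℝ} {W : Finset H} {x y : H}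
    {h : Fin k → H} (hW : ∀ ω, angle y h ω ∈ W)
    (he : ∀ i ω, ω i = false →
      g (angle (x + y) h ω) - g (angle (x + y) h ω + h i) = q i (h i) (angle (x + y) h ω))
    (ω ω' : DCube k) :
    LevelComb (differenceSet q W) (2 * k) x (g (x + angle y h ω) - g (x + angle y h ω')) := by
  classical
  have hadd : ∀ ω, angle (x + y) h ω = x + angle y h ω := fun ω => by
    rw [add_comm x y, angle_add_base, add_comm]
  have key : ∀ S : Finset (Fin k), LevelComb (differenceSet q W) (S.card : ℝ) x
      (g (x + angle y h fun _ => false) - g (x + angle y h fun i => decide (i ∈ S))) := by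
    intro S
    induction S using Finset.induction_on with
    | empty => simpa using LevelComb.zero _ x
    | insert i S hi ih =>
      have h1 : (fun j => decide (j ∈ insert i S) : DCube k) =
          Function.update (fun j => decide (j ∈ S)) i true := by
        funext j
        by_cases hj : j = i
        · subst hj; simp
        · simp [hj]
      have h2 := angle_update y h (fun j => decide (j ∈ S)) i (by simp [hi])
      have h3 : EdgeRel g q (x + angle y h fun j => decide (j ∈ S))
          (x + angle y h fun j => decide (j ∈ insert i S)) := by
        refine ⟨i, Or.inl ?_⟩
        have h4 := he i (fun j => decide (j ∈ S)) (by simp [hi])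
        rw [hadd] at h4
        rw [h1, h2, ← add_assoc, h4, add_sub_cancel_left]
      have h4 := ih.add (h3.levelComb (hW _) (hW _))
      rw [card_insert_of_notMem hi]
      push_cast
      simpa using h4
  have key' : ∀ ω, LevelComb (differenceSet q W) k x
      (g (x + angle y h fun _ => false) - g (x + angle y h ω)) := by
    intro ω
    have h1 := key (univ.filter fun i => ω i = true)
    have h2 : (fun i => decide (i ∈ univ.filter fun i => ω i = true) : DCube k) = ω := by
      funext i; simp
    rw [h2] at h1
    refine h1.mono ?_
    exact_mod_cast (card_le_univ _).trans (by simp)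
  have h1 := (key' ω).neg.add (key' ω')
  rw [neg_sub, sub_add_sub_cancel] at h1
  exact h1.mono (by linarith)

end Paths

/-! ### Extension by random shifts -/

section Extension

variable {H : Type*} [AddCommGroup H]

/-- The cube `u.1` of `G` and the points of `u.2` provide a walk from `z` to `z'`. -/
def Linked {k : ℕ} (g : H → ℝ) (q : Fin k → H → H → ℝ) (G : H × (Fin k → H) → Prop) (z z' : H)
    (u : (H × (Fin k → H)) × (H × H)) : Prop :=
  G u.1 ∧ ∃ ω ω', (EdgeRel g q z u.2.1 ∧ EdgeRel g q (angle u.1.1 u.1.2 ω) u.2.1) ∧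
    (EdgeRel g q z' u.2.2 ∧ EdgeRel g q (angle u.1.1 u.1.2 ω') u.2.2)

lemma Linked.levelComb {k : ℕ} {g : H → ℝ} {q : Fin k → H → H → ℝ} {G : H × (Fin k → H) → Prop}
    (he : ∀ p, G p → ∀ i ω, ω i = false →
      g (angle p.1 p.2 ω) - g (angle p.1 p.2 ω + p.2 i) = q i (p.2 i) (angle p.1 p.2 ω))
    {W : Finset H} {x v v' : H} {u : (H × (Fin k → H)) × (H × H)}
    (hu : Linked g q G (x + v) (x + v') (((x, 0), (x, x)) + u))
    (hv : v ∈ W) (hv' : v' ∈ W) (ha : u.2.1 ∈ W) (hb : u.2.2 ∈ W)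
    (hW : ∀ ω, angle u.1.1 u.1.2 ω ∈ W) :
    LevelComb (differenceSet q W) (2 * k + 4) x (g (x + v) - g (x + v')) := by
  obtain ⟨⟨y, h⟩, a, b⟩ := u
  obtain ⟨hG, ω, ω', ⟨h1, h2⟩, h3, h4⟩ := hu
  have hadd : ∀ ω, angle (x + y) h ω = x + angle y h ω := fun ω => by
    rw [add_comm x y, angle_add_base, add_comm]
  simp only [Prod.mk_add_mk, zero_add] at hG h1 h2 h3 h4
  simp only at ha hb hW
  rw [hadd] at h2 h4
  have e1 := h1.levelComb hv ha
  have e2 := (h2.levelComb (hW ω) ha).neg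
  have e3 := levelComb_of_edges hW (fun i ω hω => he _ hG i ω hω) ω ω'
  have e4 := h4.levelComb (hW ω') hb
  have e5 := (h3.levelComb hv' hb).neg
  have e := (((e1.add e2).add e3).add e4).add e5
  have : g (x + v) - g (x + a) + -(g (x + angle y h ω) - g (x + a)) +
      (g (x + angle y h ω) - g (x + angle y h ω')) + (g (x + angle y h ω') - g (x + b)) +
      -(g (x + v') - g (x + b)) = g (x + v) - g (x + v') := by ring
  rw [this] at e
  exact e.mono (by linarith)

lemma angle_add {k : ℕ} (p τ : H × (Fin k → H)) (ω : DCube k) :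
    angle (p + τ).1 (p + τ).2 ω = angle p.1 p.2 ω + angle τ.1 τ.2 ω := by
  unfold angle
  have : ∀ i, (if ω i = true then (p + τ).2 i else 0) =
      (if ω i = true then p.2 i else 0) + if ω i = true then τ.2 i else 0 := by
    intro i; split_ifs <;> simp
  simp only [this, sum_add_distrib, Prod.fst_add]
  abel

/-- The levels of the hierarchy of an extension: at level `s` the functions of `differenceSet q W`,
and below it the translates of the hierarchies of the functions `q i (w' - w)`. -/
noncomputable def extensionLevels {k : ℕ} (s : ℕ) (F : Fin k → H → ℕ → Finset (H → ℝ))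
    (q : Fin k → H → H → ℝ) (W : Finset H) (i : ℕ) : Finset (H → ℝ) := by
  classical
  exact if i = s then differenceSet q W else
    (univ ×ˢ W ×ˢ W).biUnion fun v : Fin k × H × H =>
      translateSet v.2.1 (F v.1 (v.2.2 - v.2.1) i)

lemma extensionLevels_self {k : ℕ} (s : ℕ) (F : Fin k → H → ℕ → Finset (H → ℝ))
    (q : Fin k → H → H → ℝ) (W : Finset H) :
    extensionLevels s F q W s = differenceSet q W := by
  simp [extensionLevels]

lemma mem_extensionLevels {k s i : ℕ} {F : Fin k → H → ℕ → Finset (H → ℝ)}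
    {q : Fin k → H → H → ℝ} {W : Finset H} (hi : i ≠ s) {φ : H → ℝ} :
    φ ∈ extensionLevels s F q W i ↔
      ∃ v : Fin k × H × H, v ∈ univ ×ˢ W ×ˢ W ∧
        φ ∈ translateSet v.2.1 (F v.1 (v.2.2 - v.2.1) i) := by
  classical
  simp only [extensionLevels, if_neg hi, mem_biUnion]

lemma translateSet_subset_extensionLevels {k s i : ℕ} {F : Fin k → H → ℕ → Finset (H → ℝ)}
    {q : Fin k → H → H → ℝ} {W : Finset H} (hi : i < s) {v : Fin k × H × H}
    (hv : v ∈ univ ×ˢ W ×ˢ W) :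
    translateSet v.2.1 (F v.1 (v.2.2 - v.2.1) i) ⊆ extensionLevels s F q W i := fun _ hφ =>
  (mem_extensionLevels hi.ne).2 ⟨v, hv, hφ⟩

lemma card_extensionLevels {k s i : ℕ} (F : Fin k → H → ℕ → Finset (H → ℝ))
    (q : Fin k → H → H → ℝ) (W : Finset H) (hi : i ≠ s) :
    (extensionLevels s F q W i).card ≤
      ∑ v ∈ (univ ×ˢ W ×ˢ W : Finset (Fin k × H × H)), (F v.1 (v.2.2 - v.2.1) i).card := by
  classical
  simp only [extensionLevels, if_neg hi]
  exact card_biUnion_le.trans (le_of_eq (sum_congr rfl fun v _ => by simp [translateSet]))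

/-- A finite set containing `V` and the points attached to the elements of a finite family. -/
lemma exists_shift_set {k m' n : ℕ} {V : Finset H} (hV : V.card ≤ n)
    (U : Fin m' → (H × (Fin k → H)) × (H × H)) :
    ∃ W : Finset H, V ⊆ W ∧ (∀ j, (U j).2.1 ∈ W ∧ (U j).2.2 ∈ W ∧
      ∀ ω, angle (U j).1.1 (U j).1.2 ω ∈ W) ∧ W.card ≤ n + m' * (2 + 2 ^ k) := by
  classical
  refine ⟨V ∪ ((univ.image fun j => (U j).2.1) ∪ ((univ.image fun j => (U j).2.2) ∪
    univ.image fun v : Fin m' × DCube k => angle (U v.1).1.1 (U v.1).1.2 v.2)),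
    subset_union_left, fun j => ?_, ?_⟩
  · simp only [mem_union, mem_image, mem_univ, true_and, Prod.exists]
    exact ⟨Or.inr (Or.inl ⟨j, rfl⟩), Or.inr (Or.inr (Or.inl ⟨j, rfl⟩)),
      fun ω => Or.inr (Or.inr (Or.inr ⟨j, ω, rfl⟩))⟩
  · refine (card_union_le _ _).trans (add_le_add hV ?_)
    refine (card_union_le _ _).trans ?_
    have h1 : (univ.image fun j => (U j).2.1).card ≤ m' := card_image_le.trans (by simp)
    have h2 : (univ.image fun j => (U j).2.2).card ≤ m' := card_image_le.trans (by simp)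
    have h3 : (univ.image fun v : Fin m' × DCube k =>
      angle (U v.1).1.1 (U v.1).1.2 v.2).card ≤ m' * 2 ^ k := card_image_le.trans (by simp)
    have h4 := card_union_le (univ.image fun j => (U j).2.2) (univ.image fun v : Fin m' × DCube k =>
      angle (U v.1).1.1 (U v.1).1.2 v.2)
    rw [mul_add]
    omega

variable [Fintype H]

lemma card_extensionLevels_le {k s : ℕ} {ε K : ℝ} {F : Fin k → H → ℕ → Finset (H → ℝ)}
    {q : Fin k → H → H → ℝ} {W : Finset H} (hF : ∀ i y, IsAlmostPoly s ε K (F i y) (q i y))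
    (hK : 1 ≤ K) (i : ℕ) (hi : i < s + 1) :
    ((extensionLevels s F q W i).card : ℝ) ≤ k * W.card ^ 2 * K := by
  classical
  by_cases his : i = s
  · subst his
    rw [extensionLevels_self]
    have h1 : ((differenceSet q W).card : ℝ) ≤ k * W.card ^ 2 := by
      exact_mod_cast card_differenceSet_le q W
    exact h1.trans (le_mul_of_one_le_right (by positivity) hK)
  · have h1 : ((univ ×ˢ W ×ˢ W : Finset (Fin k × H × H)).card : ℝ) = k * W.card ^ 2 := by
      simp [card_product, sq]
    rw [← h1]
    refine (Nat.cast_le.2 (card_extensionLevels F q W his)).trans ?_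
    push_cast
    rw [← nsmul_eq_mul, ← sum_const]
    refine sum_le_sum fun v _ => ?_
    exact (hF _ _).card_le i (by omega)

/-- The functions at the levels of an extension obey their derivatives conditions on almost all
cubes. -/
lemma pr_extensionLevels_le {k s : ℕ} {ε K K' : ℝ} {F : Fin k → H → ℕ → Finset (H → ℝ)}
    {q : Fin k → H → H → ℝ} {W : Finset H} (hF : ∀ i y, IsAlmostPoly s ε K (F i y) (q i y))
    (hK : 0 ≤ K) (hKK' : K ≤ K') (i : ℕ) (hi : i < s + 1) :
    pr (fun p : H × (Fin (i + 1) → H) => ¬ ∀ φ ∈ extensionLevels s F q W i,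
      DerivAt (extensionLevels s F q W) i K' φ (angle p.1 p.2)) ≤ k * W.card ^ 2 * ε := by
  classical
  have h1 : ((univ ×ˢ W ×ˢ W : Finset (Fin k × H × H)).card : ℝ) = k * W.card ^ 2 := by
    simp [card_product, sq]
  rw [← h1, ← nsmul_eq_mul, ← sum_const]
  by_cases his : i = s
  · subst his
    refine le_trans (pr_mono ?_) ((pr_exists_mem_le (univ ×ˢ W ×ˢ W)
      fun (v : Fin k × H × H) (p : H × (Fin (i + 1) → H)) =>
        ¬ DerivAt (F v.1 (v.2.2 - v.2.1)) i K (q v.1 (v.2.2 - v.2.1))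
          (angle (p.1 + v.2.1) p.2)).trans (sum_le_sum fun v _ => ?_))
    · intro p hp
      push Not at hp
      obtain ⟨φ, hφ, hp⟩ := hp
      rw [extensionLevels_self] at hφ
      obtain ⟨j, w, hw, w', hw', rfl⟩ := mem_differenceSet.1 hφ
      refine ⟨(j, w, w'), by simp [hw, hw'], fun hd => hp ?_⟩
      refine (derivAt_translate hd).mono (fun r hr => ?_) hK hKK'
      exact translateSet_subset_extensionLevels (v := (j, w, w')) hr (by simp [hw, hw'])
    · rw [pr_base_add (fun _ => v.2.1) fun p : H × (Fin (i + 1) → H) =>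
        ¬ DerivAt (F v.1 (v.2.2 - v.2.1)) i K (q v.1 (v.2.2 - v.2.1)) (angle p.1 p.2)]
      exact (hF _ _).top
  · refine le_trans (pr_mono ?_) ((pr_exists_mem_le (univ ×ˢ W ×ˢ W)
      fun (v : Fin k × H × H) (p : H × (Fin (i + 1) → H)) =>
        ¬ ∀ φ ∈ F v.1 (v.2.2 - v.2.1) i, DerivAt (F v.1 (v.2.2 - v.2.1)) i K φ
          (angle (p.1 + v.2.1) p.2)).trans (sum_le_sum fun v _ => ?_))
    · intro p hp
      push Not at hp
      obtain ⟨φ, hφ, hp⟩ := hp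
      obtain ⟨v, hv, hφ⟩ := (mem_extensionLevels his).1 hφ
      obtain ⟨ψ, hψ, rfl⟩ := mem_map.1 hφ
      refine ⟨v, hv, fun hd => hp ?_⟩
      refine (derivAt_translate (hd ψ hψ)).mono (fun r hr => ?_) hK hKK'
      exact translateSet_subset_extensionLevels (by omega) hv
    · rw [pr_base_add (fun _ => v.2.1) fun p : H × (Fin (i + 1) → H) =>
        ¬ ∀ φ ∈ F v.1 (v.2.2 - v.2.1) i, DerivAt (F v.1 (v.2.2 - v.2.1)) i K φ (angle p.1 p.2)]
      exact (hF _ _).level i (by omega)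

lemma pr_exists_le_card_mul {α ι : Type*} [Fintype α] [Fintype ι] [Nonempty ι] (p : ι → α → Prop) :
    pr (fun a => ∃ i, p i a) ≤ Fintype.card ι * pr fun u : α × ι => p u.2 u.1 := by
  refine (pr_exists_le p).trans (le_of_eq ?_)
  rw [pr_prod', Fintype.card_mul_expect]

lemma pr_add_left {α : Type*} [AddGroup α] [Fintype α] (a : α) (p : α → Prop) :
    pr (fun u => p (a + u)) = pr p :=
  pr_equiv (Equiv.addLeft a) p

/-- Shifts chosen at random: almost every cube is moved by shifts in `V` of its vertices to a cube of
`G` with vertices in `Y`, and for almost every `x`, any two shifts of `x` by elements of `V` that lie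
in `Y` are linked by a walk through shifts of `x` by elements of `W`. -/
lemma exists_shifts {k : ℕ} (g : H → ℝ) (q : Fin k → H → H → ℝ) (G : H × (Fin k → H) → Prop)
    (Y : Set H) {η : ℝ} (hη : 0 < η) (hη1 : η ≤ 1)
    (hY : η ≤ pr fun p => G p ∧ ∀ ω, angle p.1 p.2 ω ∈ Y)
    (hl : ∀ z ∈ Y, ∀ z' ∈ Y, η ≤ pr (Linked g q G z z')) {m m' : ℕ} (hm : 0 < m) (hm' : 0 < m') :
    ∃ (V W : Finset H) (U : Finset ((H × (Fin k → H)) × (H × H))), 0 ∈ V ∧ V ⊆ W ∧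
      (∀ u ∈ U, u.2.1 ∈ W ∧ u.2.2 ∈ W ∧ ∀ ω, angle u.1.1 u.1.2 ω ∈ W) ∧
      W.card ≤ 1 + m * 2 ^ k + m' * (2 + 2 ^ k) ∧
      pr (fun p : H × (Fin k → H) => ¬ ∃ τ : H × (Fin k → H), (∀ ω, angle τ.1 τ.2 ω ∈ V) ∧
        G (p + τ) ∧ ∀ ω, angle (p + τ).1 (p + τ).2 ω ∈ Y) ≤ 1 / (m * η) ∧
      pr (fun x : H => ∃ v ∈ V, ∃ v' ∈ V, x + v ∈ Y ∧ x + v' ∈ Y ∧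
        ∀ u ∈ U, ¬ Linked g q G (x + v) (x + v') (((x, 0), (x, x)) + u)) ≤
          (1 + m * 2 ^ k) ^ 2 / (m' * η) := by
  classical
  obtain ⟨τ, hτ⟩ := exists_sample
    (fun p t : H × (Fin k → H) => G (p + t) ∧ ∀ ω, angle (p + t).1 (p + t).2 ω ∈ Y)
    (fun _ => True) hη1
    (fun p _ => hY.trans (pr_add_left p
      fun t => G t ∧ ∀ ω, angle t.1 t.2 ω ∈ Y).symm.le) m
  obtain ⟨V, hV0, hVτ, hVcard⟩ : ∃ V : Finset H, 0 ∈ V ∧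
      (∀ j ω, angle (τ j).1 (τ j).2 ω ∈ V) ∧ V.card ≤ 1 + m * 2 ^ k := by
    refine ⟨insert 0 (univ.image fun v : Fin m × DCube k => angle (τ v.1).1 (τ v.1).2 v.2),
      mem_insert_self _ _, fun j ω => ?_, ?_⟩
    · exact mem_insert_of_mem (mem_image.2 ⟨(j, ω), mem_univ _, rfl⟩)
    · refine (card_insert_le _ _).trans ?_
      rw [add_comm 1]
      refine Nat.add_le_add_right (card_image_le.trans ?_) 1
      simp
  have : Nonempty V := ⟨⟨0, hV0⟩⟩
  obtain ⟨U, hU⟩ := exists_sample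
    (fun (c : H × (V × V)) (u : (H × (Fin k → H)) × (H × H)) =>
      Linked g q G (c.1 + c.2.1) (c.1 + c.2.2) (((c.1, 0), (c.1, c.1)) + u))
    (fun c => c.1 + c.2.1 ∈ Y ∧ c.1 + c.2.2 ∈ Y) hη1
    (fun c hc => (hl _ hc.1 _ hc.2).trans (pr_add_left
      (((c.1, 0), (c.1, c.1)) : (H × (Fin k → H)) × (H × H))
      (Linked g q G (c.1 + c.2.1) (c.1 + c.2.2))).symm.le) m'
  obtain ⟨W, hVW, hUW, hW⟩ := exists_shift_set hVcard U
  refine ⟨V, W, univ.image U, hV0, hVW, fun u hu => ?_, hW, ?_, ?_⟩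
  · obtain ⟨j, -, rfl⟩ := mem_image.1 hu
    exact hUW j
  · refine le_trans (pr_mono fun p hp => ⟨trivial, fun j hj => hp ⟨τ j, hVτ j, hj⟩⟩)
      (hτ.trans (one_sub_pow_le hη hη1 hm))
  · have h1 : pr (fun x : H => ∃ v ∈ V, ∃ v' ∈ V, x + v ∈ Y ∧ x + v' ∈ Y ∧
        ∀ u ∈ univ.image U, ¬ Linked g q G (x + v) (x + v') (((x, 0), (x, x)) + u)) ≤
        pr (fun x : H => ∃ c : V × V, (x + c.1 ∈ Y ∧ x + c.2 ∈ Y) ∧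
          ∀ j, ¬ Linked g q G (x + c.1) (x + c.2) (((x, 0), (x, x)) + U j)) := by
      refine pr_mono ?_
      rintro x ⟨v, hv, v', hv', h1, h2, h3⟩
      exact ⟨(⟨v, hv⟩, ⟨v', hv'⟩), ⟨h1, h2⟩, fun j => h3 _ (mem_image_of_mem _ (mem_univ j))⟩
    refine h1.trans ((pr_exists_le_card_mul fun (c : V × V) (x : H) =>
      (x + c.1 ∈ Y ∧ x + c.2 ∈ Y) ∧
          ∀ j, ¬ Linked g q G (x + c.1) (x + c.2) (((x, 0), (x, x)) + U j)).trans ?_)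
    have h2 : (Fintype.card (V × V) : ℝ) ≤ (1 + m * 2 ^ k) ^ 2 := by
      rw [Fintype.card_prod, Fintype.card_coe, ← sq]
      have : (V.card : ℝ) ≤ 1 + m * 2 ^ k := by exact_mod_cast hVcard
      push_cast
      exact pow_le_pow_left₀ (by positivity) this 2
    have h3 := hU.trans (one_sub_pow_le hη hη1 hm')
    calc _ ≤ (1 + m * 2 ^ k) ^ 2 * (1 / (m' * η)) :=
          mul_le_mul h2 h3 (pr_nonneg _) (by positivity)
      _ = _ := by ring

/-- A function `g` on a set `Y` of well-linked points extends to almost all of the group: the value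
of the extension at `x` is the value of `g` at a point of `Y` obtained by shifting `x`. -/
lemma exists_extension {k s : ℕ} (hk : k = s + 2) (g : H → ℝ) {G : H × (Fin k → H) → Prop}
    {F : Fin k → H → ℕ → Finset (H → ℝ)} {q : Fin k → H → H → ℝ} {ε₁ K₁ : ℝ} (hK₁ : 1 ≤ K₁)
    (hε₁ : 0 ≤ ε₁) (hF : ∀ i y, IsAlmostPoly s ε₁ K₁ (F i y) (q i y))
    (hg : ∀ p, G p → cubeDeriv g (angle p.1 p.2) = 0)
    (he : ∀ p, G p → ∀ i ω, ω i = false →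
      g (angle p.1 p.2 ω) - g (angle p.1 p.2 ω + p.2 i) = q i (p.2 i) (angle p.1 p.2 ω))
    (Y : Set H) {η : ℝ} (hη : 0 < η) (hη1 : η ≤ 1)
    (hY : η ≤ pr fun p => G p ∧ ∀ ω, angle p.1 p.2 ω ∈ Y)
    (hl : ∀ z ∈ Y, ∀ z' ∈ Y, η ≤ pr (Linked g q G z z')) {m m' : ℕ} (hm : 0 < m) (hm' : 0 < m')
    {ε K : ℝ} (h1 : k * (1 + m * 2 ^ k + m' * (2 + 2 ^ k)) ^ 2 * ε₁ ≤ ε)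
    (h2 : 1 / (m * η) + 2 ^ k * ((1 + m * 2 ^ k) ^ 2 / (m' * η)) ≤ ε)
    (h3 : k * (1 + m * 2 ^ k + m' * (2 + 2 ^ k)) ^ 2 * K₁ ≤ K) (h4 : 2 * k + 4 ≤ K) :
    ∃ (F' : ℕ → Finset (H → ℝ)) (g' : H → ℝ), IsAlmostPoly (s + 1) ε K F' g' ∧
      ∀ y ∈ Y, g y = g' y := by
  classical
  subst hk
  obtain ⟨V, W, U, hV0, hVW, hU, hW, hsh, hli⟩ := exists_shifts g q G Y hη hη1 hY hl hm hm'
  have ht : ∀ x, ∃ t, (x ∈ Y → t = 0) ∧ ((∃ v ∈ V, x + v ∈ Y) → t ∈ V ∧ x + t ∈ Y) := by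
    intro x
    by_cases hx : x ∈ Y
    · exact ⟨0, fun _ => rfl, fun _ => ⟨hV0, by simpa using hx⟩⟩
    · by_cases h : ∃ v ∈ V, x + v ∈ Y
      · obtain ⟨v, hv⟩ := h
        exact ⟨v, fun h => absurd h hx, fun _ => hv⟩
      · exact ⟨0, fun _ => rfl, fun h' => absurd h' h⟩
  choose t ht0 ht using ht
  have hWc : ((s + 2 : ℕ) : ℝ) * (W.card : ℝ) ^ 2 ≤
      ((s + 2 : ℕ) : ℝ) * (1 + m * 2 ^ (s + 2) + m' * (2 + 2 ^ (s + 2))) ^ 2 := by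
    have : (W.card : ℝ) ≤ 1 + m * 2 ^ (s + 2) + m' * (2 + 2 ^ (s + 2)) := by exact_mod_cast hW
    gcongr
  have hK0 : 0 ≤ K := le_trans (by positivity) h4
  have hKK : K₁ ≤ K := by
    refine le_trans ?_ h3
    refine le_mul_of_one_le_left (zero_le_one.trans hK₁) ?_
    have a1 : (1 : ℝ) ≤ ((s + 2 : ℕ) : ℝ) := by exact_mod_cast (by omega : 1 ≤ s + 2)
    have a2 : (1 : ℝ) ≤ (1 + m * 2 ^ (s + 2) + m' * (2 + 2 ^ (s + 2))) := by
      have : (0 : ℝ) ≤ m * 2 ^ (s + 2) + m' * (2 + 2 ^ (s + 2)) := by positivity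
      linarith
    exact one_le_mul_of_one_le_of_one_le a1 (one_le_pow₀ a2)
  refine ⟨extensionLevels s F q W, fun x => g (x + t x), ⟨hK₁.trans hKK, fun i hi => ?_,
    fun i hi => ?_, ?_⟩, fun y hy => by simp [ht0 y hy]⟩
  · exact (card_extensionLevels_le hF hK₁ i hi).trans
      ((mul_le_mul_of_nonneg_right hWc (zero_le_one.trans hK₁)).trans h3)
  · exact (pr_extensionLevels_le hF (zero_le_one.trans hK₁) hKK i hi).trans
      ((mul_le_mul_of_nonneg_right hWc hε₁).trans h1)
  · -- away from the exceptional sets, the alternating sum of `g` over the shifted cube vanishes, and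
    -- each vertex contributes the difference of `g` at two linked points
    set Bad : H → Prop := fun x => ∃ v ∈ V, ∃ v' ∈ V, x + v ∈ Y ∧ x + v' ∈ Y ∧
        ∀ u ∈ U, ¬ Linked g q G (x + v) (x + v') (((x, 0), (x, x)) + u) with hBad
    refine le_trans ?_ h2
    refine le_trans (pr_mono (q := fun p : H × (Fin (s + 2) → H) =>
      (¬ ∃ τ : H × (Fin (s + 2) → H), (∀ ω, angle τ.1 τ.2 ω ∈ V) ∧
        G (p + τ) ∧ ∀ ω, angle (p + τ).1 (p + τ).2 ω ∈ Y) ∨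
      ∃ ω, Bad (angle p.1 p.2 ω)) ?_) ((pr_or_le _ _).trans (add_le_add hsh ?_))
    · intro p hp
      by_contra hc
      push Not at hc
      obtain ⟨⟨τ, hτV, hτG, hτY⟩, hb⟩ := hc
      refine hp ⟨fun ω => g (angle p.1 p.2 ω + t (angle p.1 p.2 ω)) -
        g (angle p.1 p.2 ω + angle τ.1 τ.2 ω), fun ω => ?_, ?_⟩
      · have hYω : angle p.1 p.2 ω + angle τ.1 τ.2 ω ∈ Y := by
          rw [← angle_add]; exact hτY ω
        obtain ⟨htV, htY⟩ := ht _ ⟨_, hτV ω, hYω⟩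
        have hb' := hb ω
        rw [hBad] at hb'
        push Not at hb'
        obtain ⟨u, hu, hlink⟩ := hb' _ htV _ (hτV ω) htY hYω
        obtain ⟨hu1, hu2, hu3⟩ := hU u hu
        have hcomb := hlink.levelComb he (hVW htV) (hVW (hτV ω)) hu1 hu2 hu3
        rw [← extensionLevels_self s F q W] at hcomb
        exact (hcomb.mono h4).bddComb hK0
      · have hz := hg _ hτG
        simp only [cubeDeriv, angle_add] at hz
        simp only [cubeDeriv, mul_sub, sum_sub_distrib]
        rw [hz, sub_zero]
    · refine (pr_exists_le fun (ω : DCube (s + 2)) (p : H × (Fin (s + 2) → H)) =>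
        Bad (angle p.1 p.2 ω)).trans ?_
      simp only [pr_vertex]
      rw [sum_const, nsmul_eq_mul, card_univ]
      have hc : ((Fintype.card (DCube (s + 2)) : ℕ) : ℝ) = 2 ^ (s + 2) := by simp
      rw [hc]
      exact mul_le_mul_of_nonneg_left hli (by positivity)

end Extension

/-! ### The inductive step -/

lemma exists_nat_mem_Icc_pow {L : ℝ} (hL : 2 ≤ L) (a : ℕ) :
    ∃ m : ℕ, 0 < m ∧ L ^ a ≤ m ∧ (m : ℝ) ≤ L ^ (a + 1) := by
  have h1 : 1 ≤ L ^ a := one_le_pow₀ (by linarith)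
  refine ⟨⌈L ^ a⌉₊, Nat.ceil_pos.2 (by linarith), Nat.le_ceil _, ?_⟩
  have h2 := (Nat.ceil_lt_add_one (zero_le_one.trans h1)).le
  rw [pow_succ]
  nlinarith

/-- Numbers of shifts for which all the bounds in an extension are powers of `L = (ε δ)⁻¹`. -/
lemma exists_parameters (k a A : ℕ) : ∃ r C : ℕ, 1 ≤ r ∧ a ≤ C ∧ ∀ (L ε η : ℝ), 2 ≤ L → 2 ≤ ε * L →
    1 ≤ η * L ^ a → 0 < η → ∃ m m' : ℕ, 0 < m ∧ 0 < m' ∧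
      (k + 1 : ℕ) * (1 + m * 2 ^ (k + 1) + m' * (2 + 2 ^ (k + 1))) ^ 2 * (L ^ r)⁻¹ ≤ ε ∧
      1 / (m * η) + 2 ^ (k + 1) * ((1 + m * 2 ^ (k + 1)) ^ 2 / (m' * η)) ≤ ε ∧
      (k + 1 : ℕ) * (1 + m * 2 ^ (k + 1) + m' * (2 + 2 ^ (k + 1))) ^ 2 * (L ^ (r + 1)) ^ A ≤
        L ^ C ∧
      2 * (k + 1 : ℕ) + 4 ≤ L ^ C := by
  set B : ℝ := 2 ^ (k + 1) with hB
  have hB1 : 1 ≤ B := one_le_pow₀ (by norm_num)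
  set κ : ℝ := ((k + 1 : ℕ) : ℝ) with hκ
  have hκ1 : 1 ≤ κ := by rw [hκ]; exact_mod_cast Nat.succ_pos k
  obtain ⟨e, he⟩ := pow_unbounded_of_one_lt (16 * κ * B) (by norm_num : (1 : ℝ) < 2)
  -- exponents for `1 + m B`, `m'` and the number of shifts
  obtain ⟨v, hv⟩ : ∃ v, v = a + 2 + e := ⟨_, rfl⟩
  obtain ⟨a', ha'⟩ : ∃ a', a' = 2 * v + a + e + 1 := ⟨_, rfl⟩
  obtain ⟨w, hw⟩ : ∃ w, w = a' + 1 + e := ⟨_, rfl⟩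
  obtain ⟨r, hr⟩ : ∃ r, r = 2 * w + e + 1 := ⟨_, rfl⟩
  refine ⟨r, e + 2 * w + (r + 1) * A, by omega, by omega, ?_⟩
  intro L ε η hL hε hη hη0
  have hL0 : 0 < L := by linarith
  have hLe : 16 * κ * B ≤ L ^ e := he.le.trans (pow_le_pow_left₀ (by norm_num) hL e)
  have hκB : κ ≤ κ * B := le_mul_of_one_le_right (by linarith) hB1
  have hBκ : B ≤ κ * B := le_mul_of_one_le_left (by linarith) hκ1
  have hL1 : ∀ n, 1 ≤ L ^ n := fun n => one_le_pow₀ (by linarith)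
  have hεL : 1 / L ≤ ε / 2 := by rw [div_le_div_iff₀ hL0 (by norm_num)]; linarith
  obtain ⟨m, hm0, hm1, hm2⟩ := exists_nat_mem_Icc_pow hL (a + 1)
  obtain ⟨m', hm'0, hm'1, hm'2⟩ := exists_nat_mem_Icc_pow hL a'
  have hm1' : (1 : ℝ) ≤ m := by exact_mod_cast hm0
  have hm'1' : (1 : ℝ) ≤ m' := by exact_mod_cast hm'0
  have hV : 1 + m * B ≤ L ^ v := by
    calc 1 + m * B ≤ m * (2 * B) := by nlinarith
      _ ≤ L ^ (a + 1 + 1) * L ^ e := mul_le_mul hm2 (by linarith) (by linarith) (by positivity)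
      _ = L ^ v := by rw [← pow_add, hv]
  have hVm' : 1 + m * B ≤ m' :=
    hV.trans ((pow_le_pow_right₀ (by linarith) (by omega)).trans hm'1)
  have hW : 1 + m * B + m' * (2 + B) ≤ L ^ w := by
    calc 1 + m * B + m' * (2 + B) ≤ m' * (4 * B) := by nlinarith
      _ ≤ L ^ (a' + 1) * L ^ e := mul_le_mul hm'2 (by linarith) (by linarith) (by positivity)
      _ = L ^ w := by rw [← pow_add, hw]
  have hW0 : 0 ≤ 1 + m * B + m' * (2 + B) := by positivity
  have hκW : κ * (1 + m * B + m' * (2 + B)) ^ 2 ≤ L ^ (e + 2 * w) := by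
    calc κ * (1 + m * B + m' * (2 + B)) ^ 2 ≤ L ^ e * (L ^ w) ^ 2 :=
          mul_le_mul (by linarith) (pow_le_pow_left₀ hW0 hW 2) (by positivity) (by positivity)
      _ = _ := by rw [← pow_mul, ← pow_add]; ring_nf
  refine ⟨m, m', hm0, hm'0, ?_, ?_, ?_, ?_⟩
  · calc κ * (1 + m * B + m' * (2 + B)) ^ 2 * (L ^ r)⁻¹ ≤ L ^ (e + 2 * w) * (L ^ r)⁻¹ :=
          mul_le_mul_of_nonneg_right hκW (by positivity)
      _ = 1 / L := by
          have : r = e + 2 * w + 1 := by omega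
          rw [this, pow_succ]
          field_simp
      _ ≤ ε := by
          have : 0 < 1 / L := by positivity
          linarith
  · have h1 : 1 / (m * η) ≤ 1 / L := by
      refine one_div_le_one_div_of_le hL0 ?_
      calc L = L * 1 := (mul_one L).symm
        _ ≤ L * (η * L ^ a) := mul_le_mul_of_nonneg_left hη hL0.le
        _ = L ^ (a + 1) * η := by ring
        _ ≤ m * η := mul_le_mul_of_nonneg_right hm1 hη0.le
    have h2 : B * ((1 + m * B) ^ 2 / (m' * η)) ≤ 1 / L := by
      rw [← mul_div_assoc, div_le_div_iff₀ (by positivity) hL0, one_mul]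
      calc B * (1 + m * B) ^ 2 * L ≤ L ^ e * (L ^ v) ^ 2 * L := by
            refine mul_le_mul_of_nonneg_right ?_ hL0.le
            exact mul_le_mul (by linarith) (pow_le_pow_left₀ (by positivity) hV 2)
              (by positivity) (by positivity)
        _ = L ^ (e + 2 * v + 1) * 1 := by ring
        _ ≤ L ^ (e + 2 * v + 1) * (η * L ^ a) := mul_le_mul_of_nonneg_left hη (by positivity)
        _ = L ^ a' * η := by rw [ha']; ring
        _ ≤ m' * η := mul_le_mul_of_nonneg_right hm'1 hη0.le
    linarith
  · calc κ * (1 + m * B + m' * (2 + B)) ^ 2 * (L ^ (r + 1)) ^ A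
        ≤ L ^ (e + 2 * w) * (L ^ (r + 1)) ^ A := mul_le_mul_of_nonneg_right hκW (by positivity)
      _ = _ := by rw [← pow_mul, ← pow_add]
  · calc 2 * κ + 4 ≤ L ^ e := by linarith
      _ ≤ _ := pow_le_pow_right₀ (by linarith) (by omega)

lemma InverseStatement.succ {s : ℕ} (h : InverseStatement.{u} s) :
    InverseStatement.{u} (s + 1) := by
  obtain ⟨A, hA, hedges⟩ := h.exists_edges
  obtain ⟨D, hlinked⟩ := exists_linked_set.{u} (s + 1)
  obtain ⟨r, C, hr1, haC, hpar⟩ := exists_parameters (s + 1) (A * D) A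
  refine ⟨C, ?_⟩
  intro H _ _ g G δ ε hδ hδ2 hε hε2 hg hG
  set L : ℝ := (ε * δ)⁻¹ with hL
  have hεδ : ε * δ ≤ 1 / 2 := by nlinarith
  have hL2 : 2 ≤ L := by
    rw [hL, le_inv_comm₀ (by norm_num) (by positivity)]
    linarith
  have hL0 : 0 < L := by linarith
  have hεL : 2 ≤ ε * L := by
    have : ε * L = 1 / δ := by rw [hL]; field_simp
    rw [this, le_div_iff₀ hδ]
    linarith
  have hδL : 1 ≤ δ * L := by
    have : δ * L = 1 / ε := by rw [hL]; field_simp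
    rw [this, le_div_iff₀ hε]
    linarith
  have hδ1 : δ ≤ 1 := by linarith
  set η : ℝ := δ ^ (A * D) with hη
  have hη0 : 0 < η := by positivity
  obtain ⟨m, m', hm, hm', p1, p2, p3, p4⟩ := hpar L ε η hL2 hεL
    (by rw [hη, ← mul_pow]; exact one_le_pow₀ hδL) hη0
  set ε₁ : ℝ := (L ^ r)⁻¹ with hε₁
  have hε₁0 : 0 < ε₁ := by positivity
  have hε₁2 : ε₁ ≤ 1 / 2 := by
    rw [hε₁, inv_le_comm₀ (by positivity) (by norm_num)]
    calc ((1 : ℝ) / 2)⁻¹ = 2 := by norm_num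
      _ ≤ L := hL2
      _ ≤ L ^ r := le_self_pow₀ (by linarith) (by omega)
  obtain ⟨F, q, G₁, k1, k2, k3, k4⟩ := hedges H g G δ ε₁ hδ hδ2 hε₁0 hε₁2 hg hG
  obtain ⟨Y, hY, hl⟩ := hlinked H (EdgeRel g q) G₁ (δ ^ A) (by positivity)
    ((pow_le_of_le_one hδ.le hδ1 (by omega)).trans hδ2) k2 (by
      intro p hp ω
      cases hω : ω 0
      · refine ⟨0, Or.inl ?_⟩
        have h1 := k4 p hp 0 ω hω
        rw [Bool.not_false, angle_update _ _ _ _ hω, h1, add_sub_cancel_left]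
      · refine ⟨0, Or.inr ?_⟩
        have h1 := k4 p hp 0 (Function.update ω 0 false) (by simp)
        have h2 := angle_update p.1 p.2 (Function.update ω 0 false) 0 (by simp)
        rw [Function.update_idem, ← hω, Function.update_eq_self] at h2
        rw [Bool.not_true, h2, h1, add_sub_cancel_left])
  rw [← pow_mul, ← hη] at hY
  have hl' : ∀ z ∈ Y, ∀ z' ∈ Y, η ≤ pr (Linked g q G₁ z z') := by
    intro z hz z' hz'
    have h1 := hl z hz z' hz'
    rwa [← pow_mul, ← hη] at h1
  have hK₁ : ((ε₁ * δ) ^ A)⁻¹ ≤ (L ^ (r + 1)) ^ A := by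
    rw [← inv_pow]
    refine pow_le_pow_left₀ (by positivity) ?_ A
    rw [mul_inv, hε₁, inv_inv, pow_succ]
    refine mul_le_mul_of_nonneg_left ?_ (by positivity)
    rw [inv_le_iff_one_le_mul₀ hδ, mul_comm]
    exact hδL
  obtain ⟨F', g', h1, h2⟩ := exists_extension rfl g
    (one_le_pow₀ (one_le_pow₀ (by linarith : 1 ≤ L))) hε₁0.le
    (fun i y => (k3 i y).mono le_rfl hK₁) (fun p hp => hg p (k1 p hp)) k4 Y hη0
    (pow_le_one₀ hδ.le hδ1) hY hl' hm hm' p1 p2 p3 p4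
  refine ⟨F', g', Y, ?_, h2, ?_⟩
  · rwa [← inv_pow]
  · refine (pow_le_pow_of_le_one hδ.le hδ1 haC).trans (hY.trans (pr_mono fun p hp => ?_))
    exact ⟨k1 p hp.1, hp.2⟩

/-- The inverse theorem in every degree, with exceptional sets of cubes. -/
theorem inverseStatement (s : ℕ) : InverseStatement.{u} s := by
  induction s with
  | zero => exact inverseStatement_zero
  | succ s ih => exact ih.succ

/-! ### Faces and gluing -/

section Faces

/-- The restriction of `c` to the face with active coordinates `e 0, e 1, …`, in this order, the
other coordinates being fixed by `η`. -/
noncomputable def face {A : Type*} {d k : ℕ} (c : DCube k → A) (e : Fin d ↪ Fin k) (η : DCube k) :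
    DCube d → A :=
  fun ω => c (Function.extend e ω η)

/-- The family of sets `P k` of configurations is closed under permutations and reflections of the
coordinates. -/
structure IsSymmFamily {A : Type*} (P : (k : ℕ) → Set (DCube k → A)) : Prop where
  perm : ∀ k, ∀ c ∈ P k, ∀ σ : Equiv.Perm (Fin k), (fun ω => c (ω ∘ σ)) ∈ P k
  reflect : ∀ k, ∀ c ∈ P k, ∀ i : Fin k, (fun ω => c (Function.update ω i (!(ω i)))) ∈ P k

variable {A : Type*} {d k : ℕ}

lemma extend_comp_perm (e : Fin d ↪ Fin k) (η : DCube k) (ω : DCube d) (σ : Equiv.Perm (Fin k)) :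
    Function.extend e ω η ∘ σ =
      Function.extend (e.trans σ.symm.toEmbedding) ω (η ∘ σ) := by
  funext i
  by_cases h : ∃ j, e j = σ i
  · obtain ⟨j, hj⟩ := h
    have hj' : (e.trans σ.symm.toEmbedding) j = i := by simp [hj]
    rw [Function.comp_apply, ← hj, e.injective.extend_apply]
    conv_rhs => rw [← hj']
    rw [Function.Embedding.injective _ |>.extend_apply]
  · have h' : ¬ ∃ j, (e.trans σ.symm.toEmbedding) j = i := by
      rintro ⟨j, hj⟩
      exact h ⟨j, by simpa [Equiv.symm_apply_eq] using hj⟩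
    rw [Function.comp_apply, Function.extend_apply' _ _ _ h, Function.extend_apply' _ _ _ h',
      Function.comp_apply]

lemma update_extend_of_mem (e : Fin d ↪ Fin k) (η : DCube k) (ω : DCube d) (j : Fin d) (b : Bool) :
    Function.update (Function.extend e ω η) (e j) b =
      Function.extend e (Function.update ω j b) η := by
  funext i
  by_cases h : ∃ j, e j = i
  · obtain ⟨l, rfl⟩ := h
    rw [e.injective.extend_apply]
    by_cases hl : l = j
    · subst hl; simp
    · rw [Function.update_of_ne hl, Function.update_of_ne (fun h => hl (e.injective h)),
        e.injective.extend_apply]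
  · rw [Function.extend_apply' _ _ _ h, Function.update_of_ne (fun h' => h ⟨j, h'.symm⟩),
      Function.extend_apply' _ _ _ h]

lemma update_extend_of_notMem (e : Fin d ↪ Fin k) (η : DCube k) (ω : DCube d) (i : Fin k)
    (hi : ¬ ∃ j, e j = i) (b : Bool) :
    Function.update (Function.extend e ω η) i b = Function.extend e ω (Function.update η i b) := by
  funext l
  by_cases h : ∃ j, e j = l
  · obtain ⟨j, rfl⟩ := h
    rw [e.injective.extend_apply, Function.update_of_ne (fun h => hi ⟨j, h⟩),
      e.injective.extend_apply]
  · rw [Function.extend_apply' _ _ _ h]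
    by_cases hl : l = i
    · subst hl; simp
    · rw [Function.update_of_ne hl, Function.update_of_ne hl, Function.extend_apply' _ _ _ h]

lemma extend_extend {d' : ℕ} (e : Fin d ↪ Fin k) (e' : Fin d' ↪ Fin d) (η : DCube k)
    (η' : DCube d) (ω : DCube d') :
    Function.extend e (Function.extend e' ω η') η =
      Function.extend (e'.trans e) ω (Function.extend e η' η) := by
  funext i
  by_cases h : ∃ j, e j = i
  · obtain ⟨j, rfl⟩ := h
    rw [e.injective.extend_apply]
    by_cases h' : ∃ l, e' l = j
    · obtain ⟨l, rfl⟩ := h'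
      rw [e'.injective.extend_apply]
      exact ((e'.trans e).injective.extend_apply ω _ l).symm
    · rw [Function.extend_apply' _ _ _ h', Function.extend_apply', e.injective.extend_apply]
      rintro ⟨l, hl⟩
      exact h' ⟨l, e.injective hl⟩
  · rw [Function.extend_apply' _ _ _ h, Function.extend_apply', Function.extend_apply' _ _ _ h]
    rintro ⟨l, hl⟩
    exact h ⟨e' l, hl⟩

lemma face_face {d' : ℕ} (c : DCube k → A) (e : Fin d ↪ Fin k) (e' : Fin d' ↪ Fin d) (η : DCube k)
    (η' : DCube d) :
    face (face c e η) e' η' = face c (e'.trans e) (Function.extend e η' η) := by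
  funext ω
  simp only [face, extend_extend]

lemma face_refl (c : DCube k → A) (η : DCube k) : face c (Function.Embedding.refl _) η = c := by
  funext ω
  unfold face
  congr 1
  funext i
  exact (Function.Embedding.refl (Fin k)).injective.extend_apply ω η i

/-- Gluing along the direction `j` is gluing along the last direction, up to the permutation that
moves the last coordinate to the position `j`. -/
lemma glue_eq_perm (j : Fin (k + 1)) (c c' : DCube k → A) :
    glue j c c' = fun ω => glue (Fin.last k) c c'
      (ω ∘ ((finSuccEquivLast (n := k)).trans (finSuccEquiv' j).symm : Equiv.Perm (Fin (k + 1)))) := by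
  funext ω
  unfold glue
  have h1 : (ω ∘ ((finSuccEquivLast (n := k)).trans (finSuccEquiv' j).symm :
      Equiv.Perm (Fin (k + 1)))) (Fin.last k) = ω j := by simp
  have h2 : (Fin.last k).removeNth (ω ∘ ((finSuccEquivLast (n := k)).trans (finSuccEquiv' j).symm :
      Equiv.Perm (Fin (k + 1)))) = j.removeNth ω := by
    funext i; simp [Fin.removeNth]
  rw [h1, h2]

lemma glue_perm (c c' : DCube k → A) (σ : Equiv.Perm (Fin k)) :
    glue (Fin.last k) (fun ω => c (ω ∘ σ)) (fun ω => c' (ω ∘ σ)) =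
      fun ω => glue (Fin.last k) c c' (ω ∘ ((finSuccEquivLast (n := k)).trans
        ((Equiv.optionCongr σ).trans finSuccEquivLast.symm) : Equiv.Perm (Fin (k + 1)))) := by
  funext ω
  unfold glue
  have h1 : (ω ∘ ((finSuccEquivLast (n := k)).trans
      ((Equiv.optionCongr σ).trans finSuccEquivLast.symm) : Equiv.Perm (Fin (k + 1))))
      (Fin.last k) = ω (Fin.last k) := by simp
  have h2 : (Fin.last k).removeNth (ω ∘ ((finSuccEquivLast (n := k)).trans
      ((Equiv.optionCongr σ).trans finSuccEquivLast.symm) : Equiv.Perm (Fin (k + 1)))) =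
      (Fin.last k).removeNth ω ∘ σ := by
    funext i; simp [Fin.removeNth, Fin.init]
  rw [h1, h2]

lemma glue_reflect (c c' : DCube k → A) (i : Fin k) :
    glue (Fin.last k) (fun ω => c (Function.update ω i (!ω i)))
        (fun ω => c' (Function.update ω i (!ω i))) =
      fun ω => glue (Fin.last k) c c' (Function.update ω i.castSucc (!ω i.castSucc)) := by
  funext ω
  unfold glue
  have h1 : Function.update ω i.castSucc (!ω i.castSucc) (Fin.last k) = ω (Fin.last k) :=
    Function.update_of_ne (Fin.castSucc_lt_last i).ne' _ _
  have h2 : (Fin.last k).removeNth (Function.update ω i.castSucc (!ω i.castSucc)) =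
      Function.update ((Fin.last k).removeNth ω) i (!(Fin.last k).removeNth ω i) := by
    funext l
    by_cases hl : l = i
    · subst hl; simp [Fin.removeNth]
    · rw [Function.update_of_ne hl]
      simp only [Fin.removeNth, Fin.succAbove_last]
      exact Function.update_of_ne (fun h => hl (Fin.castSucc_injective _ h)) _ _
  rw [h1, h2]

/-- A face of a glued configuration that does not use the last direction is a face of one of the two
configurations. -/
lemma face_glue_of_notMem (c c' : DCube k → A) (e : Fin d ↪ Fin (k + 1)) (η : DCube (k + 1))
    (he : ¬ ∃ j, e j = Fin.last k) : ∃ e' : Fin d ↪ Fin k, face (glue (Fin.last k) c c') e η =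
      if η (Fin.last k) = true then face c' e' ((Fin.last k).removeNth η) else
        face c e' ((Fin.last k).removeNth η) := by
  have hne : ∀ j, e j ≠ Fin.last k := fun j hj => he ⟨j, hj⟩
  let e' : Fin d ↪ Fin k := ⟨fun j => (e j).castPred (hne j), fun a b hab => by
    simpa using hab⟩
  have he' : ∀ j, (e' j).castSucc = e j := fun j => Fin.castSucc_castPred _ (hne _)
  refine ⟨e', ?_⟩
  have key : ∀ ω : DCube d, (Fin.last k).removeNth (Function.extend e ω η) =
      Function.extend e' ω ((Fin.last k).removeNth η) := by
    intro ω
    funext i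
    simp only [Fin.removeNth, Fin.succAbove_last]
    by_cases h : ∃ j, e' j = i
    · obtain ⟨j, rfl⟩ := h
      rw [he', e.injective.extend_apply, e'.injective.extend_apply]
    · rw [Function.extend_apply' _ _ _ h, Function.extend_apply']
      · simp only [Fin.removeNth, Fin.succAbove_last]
      · rintro ⟨j, hj⟩
        exact h ⟨j, Fin.castSucc_injective _ (by rw [he', hj])⟩
  funext ω
  have h1 : Function.extend e ω η (Fin.last k) = η (Fin.last k) := Function.extend_apply' _ _ _ he
  simp only [face, glue, h1, key]
  split_ifs <;> rfl

/-- A face of a glued configuration that uses the last direction is obtained by gluing faces. -/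
lemma face_glue_of_mem (c c' : DCube k → A) (e : Fin (d + 1) ↪ Fin (k + 1)) (η : DCube (k + 1))
    (j : Fin (d + 1)) (hj : e j = Fin.last k) : ∃ e' : Fin d ↪ Fin k,
      face (glue (Fin.last k) c c') e η = glue j (face c e' ((Fin.last k).removeNth η))
        (face c' e' ((Fin.last k).removeNth η)) := by
  have hne : ∀ l, e (j.succAbove l) ≠ Fin.last k := fun l hl =>
    Fin.succAbove_ne j l (e.injective (hl.trans hj.symm))
  let e' : Fin d ↪ Fin k := ⟨fun l => (e (j.succAbove l)).castPred (hne l), fun a b hab => by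
    simpa using hab⟩
  have he' : ∀ l, (e' l).castSucc = e (j.succAbove l) := fun l => Fin.castSucc_castPred _ (hne _)
  refine ⟨e', ?_⟩
  have key : ∀ ω : DCube (d + 1), (Fin.last k).removeNth (Function.extend e ω η) =
      Function.extend e' (j.removeNth ω) ((Fin.last k).removeNth η) := by
    intro ω
    funext i
    by_cases h : ∃ l, e' l = i
    · obtain ⟨l, rfl⟩ := h
      rw [e'.injective.extend_apply]
      simp only [Fin.removeNth, Fin.succAbove_last]
      rw [he', e.injective.extend_apply]
    · rw [Function.extend_apply' _ _ _ h]
      simp only [Fin.removeNth, Fin.succAbove_last]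
      rw [Function.extend_apply']
      rintro ⟨l, hl⟩
      rcases Fin.eq_self_or_eq_succAbove j l with rfl | ⟨l', rfl⟩
      · exact (Fin.castSucc_lt_last i).ne (hl.symm.trans hj)
      · exact h ⟨l', Fin.castSucc_injective _ (by rw [he', hl])⟩
  funext ω
  have h1 : Function.extend e ω η (Fin.last k) = ω j := by
    rw [← hj, e.injective.extend_apply]
  simp only [face, glue, h1, key]

variable {H : Type*} [AddCommGroup H]

lemma glue_angle (x y : H) (h : Fin k → H) :
    glue (Fin.last k) (angle x h) (fun ω => angle x h ω + y) =
      angle x ((Fin.last k).insertNth y h : Fin (k + 1) → H) := by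
  funext ω
  rw [angle_insertNth]
  unfold glue
  split_ifs <;> simp

lemma glue_angle_mem_cubes {c : DCube k → H} (hc : c ∈ cubes H k) (y : H) :
    glue (Fin.last k) c (fun ω => c ω + y) ∈ cubes H (k + 1) := by
  obtain ⟨x, h, rfl⟩ := hc
  exact ⟨x, _, glue_angle x y h⟩

lemma face_mem_cubes {c : DCube k → H} (hc : c ∈ cubes H k) (e : Fin d ↪ Fin k) (η : DCube k) :
    face c e η ∈ cubes H d := by
  classical
  obtain ⟨x, h, rfl⟩ := hc
  refine ⟨x + ∑ i ∈ (univ.map e)ᶜ, if η i = true then h i else 0, h ∘ e, ?_⟩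
  funext ω
  unfold face angle
  rw [add_assoc, ← sum_add_sum_compl (univ.map e), sum_map, add_comm (∑ i, _)]
  congr 2
  · refine sum_congr rfl fun i hi => ?_
    rw [Function.extend_apply']
    rintro ⟨j, rfl⟩
    simp at hi
  · refine sum_congr rfl fun j _ => ?_
    rw [e.injective.extend_apply]
    rfl

lemma perm_mem_cubes {c : DCube k → H} (hc : c ∈ cubes H k) (σ : Equiv.Perm (Fin k)) :
    (fun ω => c (ω ∘ σ)) ∈ cubes H k := by
  obtain ⟨x, h, rfl⟩ := hc
  refine ⟨x, h ∘ σ.symm, ?_⟩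
  funext ω
  unfold angle
  congr 1
  rw [← Equiv.sum_comp σ fun j => if ω j = true then (h ∘ σ.symm) j else 0]
  simp

lemma reflect_mem_cubes {c : DCube k → H} (hc : c ∈ cubes H k) (i : Fin k) :
    (fun ω => c (Function.update ω i (!(ω i)))) ∈ cubes H k := by
  classical
  obtain ⟨x, h, rfl⟩ := hc
  refine ⟨x + h i, Function.update h i (- h i), ?_⟩
  funext ω
  rw [angle_flip]
  unfold angle
  rw [← add_sum_erase univ (fun j => if ω j = true then h j else 0) (mem_univ i),
    ← add_sum_erase univ (fun j => if ω j = true then Function.update h i (-h i) j else 0)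
      (mem_univ i)]
  have h1 : ∑ j ∈ univ.erase i, (if ω j = true then Function.update h i (-h i) j else 0) =
      ∑ j ∈ univ.erase i, if ω j = true then h j else 0 :=
    sum_congr rfl fun j hj => by rw [Function.update_of_ne (ne_of_mem_erase hj)]
  rw [h1]
  cases ω i <;> simp <;> abel

end Faces

/-! ### Systems of cubes from sets of almost all cubes -/

section System

variable {H : Type*} [AddCommGroup H] [Fintype H]

/-- The configurations in `P` whose extension in a random direction lies in `Q` up to probability
`κ`. -/
def extendable (κ : ℝ) {d : ℕ} (P : Set (DCube d → H)) (Q : Set (DCube (d + 1) → H)) :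
    Set (DCube d → H) :=
  {c | c ∈ P ∧ pr (fun y => glue (Fin.last d) c (fun ω => c ω + y) ∉ Q) ≤ κ}

/-- The configurations of dimension `d` in `P` that can be extended `j` times in most directions.
The requirement that most translates be extendable is invariant under translation, so that most
translates of a configuration in this set belong to it. -/
def robustCubes (P : (k : ℕ) → Set (DCube k → H)) (κ : ℝ) : ℕ → (d : ℕ) → Set (DCube d → H)
  | 0, d => P d
  | j + 1, d => {c | c ∈ extendable κ (P d) (robustCubes P κ j (d + 1)) ∧
      pr (fun y => (fun ω => c ω + y) ∉ extendable κ (P d) (robustCubes P κ j (d + 1))) ≤ κ}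

lemma robustCubes_subset (P : (k : ℕ) → Set (DCube k → H)) (κ : ℝ) (j d : ℕ) :
    robustCubes P κ j d ⊆ P d := by
  cases j with
  | zero => exact subset_rfl
  | succ j => exact fun c hc => hc.1.1

lemma pr_glue_robustCubes_le {P : (k : ℕ) → Set (DCube k → H)} {κ : ℝ} {j d : ℕ}
    {c : DCube d → H} (hc : c ∈ robustCubes P κ (j + 1) d) :
    pr (fun y => glue (Fin.last d) c (fun ω => c ω + y) ∉ robustCubes P κ j (d + 1)) ≤ κ :=
  hc.1.2

lemma pr_translate_robustCubes_le {P : (k : ℕ) → Set (DCube k → H)} {κ : ℝ} {j d : ℕ}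
    {c : DCube d → H} (hc : c ∈ robustCubes P κ (j + 1) d) :
    pr (fun y => (fun ω => c ω + y) ∉ robustCubes P κ (j + 1) d) ≤ κ := by
  refine (pr_mono fun y hy => ?_).trans hc.2
  intro h
  refine hy ⟨h, ?_⟩
  have h1 := pr_add_left y fun z => (fun ω => c ω + z) ∉
    extendable κ (P d) (robustCubes P κ j (d + 1))
  simp only [add_assoc]
  exact h1.le.trans hc.2

lemma isSymmFamily_robustCubes {P : (k : ℕ) → Set (DCube k → H)} (hP : IsSymmFamily P) (κ : ℝ)
    (j : ℕ) : IsSymmFamily (robustCubes P κ j) := by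
  induction j with
  | zero => exact hP
  | succ j ih =>
    have hp : ∀ d, ∀ c ∈ extendable κ (P d) (robustCubes P κ j (d + 1)), ∀ σ : Equiv.Perm (Fin d),
        (fun ω => c (ω ∘ σ)) ∈ extendable κ (P d) (robustCubes P κ j (d + 1)) := by
      intro d c hc σ
      refine ⟨hP.perm d c hc.1 σ, (pr_mono fun y hy h => hy ?_).trans hc.2⟩
      rw [glue_perm c (fun ω => c ω + y) σ]
      exact ih.perm _ _ h _
    have hr : ∀ d, ∀ c ∈ extendable κ (P d) (robustCubes P κ j (d + 1)), ∀ i : Fin d,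
        (fun ω => c (Function.update ω i (!ω i))) ∈
          extendable κ (P d) (robustCubes P κ j (d + 1)) := by
      intro d c hc i
      refine ⟨hP.reflect d c hc.1 i, (pr_mono fun y hy h => hy ?_).trans hc.2⟩
      rw [glue_reflect c (fun ω => c ω + y) i]
      exact ih.reflect _ _ h _
    exact ⟨fun d c hc σ => ⟨hp d c hc.1 σ, (pr_mono fun y hy h => hy (hp d _ h σ)).trans hc.2⟩,
      fun d c hc i => ⟨hr d c hc.1 i, (pr_mono fun y hy h => hy (hr d _ h i)).trans hc.2⟩⟩

lemma pr_not_extendable_le {P : (k : ℕ) → Set (DCube k → H)} {κ κ₀ κ₁ : ℝ} {d : ℕ} (hκ : 0 < κ)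
    {Q : Set (DCube (d + 1) → H)}
    (hP : pr (fun p : H × (Fin d → H) => angle p.1 p.2 ∉ P d) ≤ κ₀)
    (hQ : pr (fun p : H × (Fin (d + 1) → H) => angle p.1 p.2 ∉ Q) ≤ κ₁) :
    pr (fun p : H × (Fin d → H) => angle p.1 p.2 ∉ extendable κ (P d) Q) ≤ κ₀ + κ₁ / κ := by
  have h1 : pr (fun p : H × (Fin d → H) => κ ≤ pr fun y =>
      glue (Fin.last d) (angle p.1 p.2) (fun ω => angle p.1 p.2 ω + y) ∉ Q) ≤ κ₁ / κ := by
    refine pr_le_div (fun p => pr_nonneg _) hκ ?_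
    simp only [glue_angle]
    rw [pr_insertNth (Fin.last d), pr_prod'] at hQ
    exact hQ
  refine le_trans (pr_mono fun p hp => ?_) ((pr_or_le _ _).trans (add_le_add hP h1))
  by_cases h : angle p.1 p.2 ∈ P d
  · exact Or.inr (not_le.1 fun h' => hp ⟨h, h'⟩).le
  · exact Or.inl h

lemma pr_not_robustCubes_le {P : (k : ℕ) → Set (DCube k → H)} {κ κ₀ : ℝ} {s : ℕ} (hκ : 0 < κ)
    (hκ1 : κ ≤ 1) (hκ₀ : 0 ≤ κ₀)
    (hP : ∀ d ≤ s, pr (fun p : H × (Fin d → H) => angle p.1 p.2 ∉ P d) ≤ κ₀) (j d : ℕ)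
    (hd : d + j = s) :
    pr (fun p : H × (Fin d → H) => angle p.1 p.2 ∉ robustCubes P κ j d) ≤
      κ₀ * (4 / κ ^ 2) ^ j := by
  induction j generalizing d with
  | zero => simpa [robustCubes] using hP d (by omega)
  | succ j ih =>
    set κ₁ : ℝ := κ₀ * (4 / κ ^ 2) ^ j with hκ₁
    have hE := pr_not_extendable_le hκ (hP d (by omega)) (ih (d + 1) (by omega))
    have h1 : (1 : ℝ) ≤ 4 / κ ^ 2 := by
      rw [le_div_iff₀ (by positivity)]; nlinarith
    have h2 : κ₀ ≤ κ₁ := le_mul_of_one_le_right hκ₀ (one_le_pow₀ h1)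
    have h3 : κ₁ ≤ κ₁ / κ := by
      rw [le_div_iff₀ hκ]; nlinarith
    have h4 : pr (fun p : H × (Fin d → H) => κ ≤ pr fun y => (fun ω => angle p.1 p.2 ω + y) ∉
        extendable κ (P d) (robustCubes P κ j (d + 1))) ≤ (κ₀ + κ₁ / κ) / κ := by
      refine pr_le_div (fun p => pr_nonneg _) hκ ?_
      rw [← pr_prod fun u : (H × (Fin d → H)) × H => (fun ω => angle u.1.1 u.1.2 ω + u.2) ∉
        extendable κ (P d) (robustCubes P κ j (d + 1)), pr_prod']
      refine expect_le univ_nonempty fun y _ => ?_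
      have h5 : ∀ p : H × (Fin d → H), (fun ω => angle p.1 p.2 ω + y) = angle (p.1 + y) p.2 :=
        fun p => by funext ω; rw [angle_add_base]
      simp only [h5]
      rw [pr_base_add (fun _ => y) fun p : H × (Fin d → H) =>
        angle p.1 p.2 ∉ extendable κ (P d) (robustCubes P κ j (d + 1))]
      exact hE
    have h5 : pr (fun p : H × (Fin d → H) => angle p.1 p.2 ∉ robustCubes P κ (j + 1) d) ≤
        (κ₀ + κ₁ / κ) + (κ₀ + κ₁ / κ) / κ := by
      refine le_trans (pr_mono fun p hp => ?_) ((pr_or_le _ _).trans (add_le_add hE h4))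
      by_cases h : angle p.1 p.2 ∈ extendable κ (P d) (robustCubes P κ j (d + 1))
      · exact Or.inr (not_le.1 fun h' => hp ⟨h, h'⟩).le
      · exact Or.inl h
    refine h5.trans ?_
    have h6 : κ₀ + κ₁ / κ ≤ 2 * (κ₁ / κ) := by linarith
    have h7 : κ₁ / κ ≤ κ₁ / κ / κ := by
      rw [le_div_iff₀ hκ]
      have : 0 ≤ κ₁ / κ := le_trans (le_trans hκ₀ h2) h3
      nlinarith
    calc (κ₀ + κ₁ / κ) + (κ₀ + κ₁ / κ) / κ ≤ 2 * (κ₁ / κ) + 2 * (κ₁ / κ) / κ := by gcongr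
      _ ≤ 4 * (κ₁ / κ / κ) := by
          have h8 : 2 * (κ₁ / κ) / κ = 2 * (κ₁ / κ / κ) := by ring
          rw [h8]
          linarith
      _ = κ₀ * (4 / κ ^ 2) ^ (j + 1) := by
          rw [hκ₁, pow_succ]
          ring

/-- The cubes all of whose faces are robust. -/
def robustSystem (P : (k : ℕ) → Set (DCube k → H)) (κ : ℝ) (s k : ℕ) : Set (DCube k → H) :=
  {c | c ∈ cubes H k ∧ ∀ (d : ℕ) (e : Fin d ↪ Fin k) (η : DCube k),
    face c e η ∈ robustCubes P κ (s + 1 - d) d}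

/-- The number of ways to choose a face of the cube of dimension `k`. -/
noncomputable def faceCount (k : ℕ) : ℕ :=
  Fintype.card (Σ d : Fin (k + 1), (Fin d ↪ Fin k) × DCube k)

/-- A face of the cube glued from `c` and `c + y` is a face `E` of `c`, or `E + y`, or is glued from
`E` and `E + y`; each of these is robust for most `y`. -/
lemma pr_not_robustSystem_le {P : (k : ℕ) → Set (DCube k → H)} (hP : IsSymmFamily P) {κ : ℝ}
    {s k : ℕ} (hk : k ≤ s) {c : DCube k → H} (hc : c ∈ robustSystem P κ s k) :
    pr (fun y => glue (Fin.last k) c (fun ω => c ω + y) ∉ robustSystem P κ s (k + 1)) ≤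
      faceCount k * (2 * κ) := by
  have key : ∀ v : (Σ d : Fin (k + 1), (Fin d ↪ Fin k) × DCube k),
      pr (fun y => (fun ω => face c v.2.1 v.2.2 ω + y) ∉ robustCubes P κ (s + 1 - v.1) v.1 ∨
        glue (Fin.last v.1) (face c v.2.1 v.2.2) (fun ω => face c v.2.1 v.2.2 ω + y) ∉
          robustCubes P κ (s + 1 - (v.1 + 1)) (v.1 + 1)) ≤ 2 * κ := by
    intro v
    have hv := v.1.isLt
    have h1 := hc.2 v.1 v.2.1 v.2.2
    have h2 : s + 1 - (v.1 : ℕ) = (s - v.1) + 1 := by omega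
    have h3 : s + 1 - ((v.1 : ℕ) + 1) = s - v.1 := by omega
    rw [h2] at h1
    rw [h2, h3]
    refine (pr_or_le _ _).trans ?_
    rw [two_mul]
    exact add_le_add (pr_translate_robustCubes_le h1) (pr_glue_robustCubes_le h1)
  refine le_trans (pr_mono fun y hy => ?_) ((pr_exists_le fun
    (v : (Σ d : Fin (k + 1), (Fin d ↪ Fin k) × DCube k)) y =>
      (fun ω => face c v.2.1 v.2.2 ω + y) ∉ robustCubes P κ (s + 1 - v.1) v.1 ∨
        glue (Fin.last v.1) (face c v.2.1 v.2.2) (fun ω => face c v.2.1 v.2.2 ω + y) ∉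
          robustCubes P κ (s + 1 - (v.1 + 1)) (v.1 + 1)).trans
      ((sum_le_sum fun v _ => key v).trans ?_))
  · by_contra hcon
    push Not at hcon
    refine hy ⟨glue_angle_mem_cubes hc.1 y, fun d e η => ?_⟩
    by_cases he : ∃ j, e j = Fin.last k
    · obtain ⟨j, hj⟩ := he
      obtain _ | d := d
      · exact j.elim0
      obtain ⟨e', he'⟩ := face_glue_of_mem c (fun ω => c ω + y) e η j hj
      have hd : d < k + 1 := by
        have := Fintype.card_le_of_embedding e'
        simp at this; omega
      rw [he', glue_eq_perm]
      exact (isSymmFamily_robustCubes hP κ _).perm _ _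
        (hcon ⟨⟨d, hd⟩, e', (Fin.last k).removeNth η⟩).2 _
    · obtain ⟨e', he'⟩ := face_glue_of_notMem c (fun ω => c ω + y) e η he
      have hd : d < k + 1 := by
        have := Fintype.card_le_of_embedding e'
        simp at this; omega
      rw [he']
      split_ifs
      · exact (hcon ⟨⟨d, hd⟩, e', (Fin.last k).removeNth η⟩).1
      · exact hc.2 _ _ _
  · rw [sum_const, nsmul_eq_mul, card_univ]
    exact le_rfl

lemma robustSystem_subset (P : (k : ℕ) → Set (DCube k → H)) (κ : ℝ) (s k : ℕ) :
    robustSystem P κ s k ⊆ P k := by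
  intro c hc
  have h := hc.2 k (Function.Embedding.refl _) (fun _ => false)
  rw [face_refl] at h
  exact robustCubes_subset _ _ _ _ h

lemma isCubeSystem_robustSystem {P : (k : ℕ) → Set (DCube k → H)} (hP : IsSymmFamily P) {κ ε : ℝ}
    {s : ℕ} (hε : ε < 1) (hκ : ∀ k ≤ s, faceCount k * (2 * κ) ≤ ε) :
    IsCubeSystem s (1 - ε) (robustSystem P κ s) := by
  refine ⟨by linarith, fun k _ c hc => hc.1, fun k _ c hc σ => ?_, fun k _ c hc i => ?_,
    fun k _ c hc d e η => ?_, fun k hk c hc => ?_⟩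
  · refine ⟨perm_mem_cubes hc.1 σ, fun d e η => ?_⟩
    have h := hc.2 d (e.trans σ.symm.toEmbedding) (η ∘ σ)
    unfold face at h ⊢
    simpa only [extend_comp_perm] using h
  · refine ⟨reflect_mem_cubes hc.1 i, fun d e η => ?_⟩
    by_cases hi : ∃ j, e j = i
    · obtain ⟨j, rfl⟩ := hi
      have h := (isSymmFamily_robustCubes hP κ _).reflect _ _ (hc.2 d e η) j
      unfold face at h ⊢
      simpa only [update_extend_of_mem, e.injective.extend_apply] using h
    · have h := hc.2 d e (Function.update η i (!η i))
      unfold face at h ⊢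
      simpa only [update_extend_of_notMem _ _ _ _ hi, Function.extend_apply' _ _ _ hi] using h
  · refine ⟨face_mem_cubes hc.1 e.toEmbedding η, fun d' e' η' => ?_⟩
    have h := hc.2 d' (e'.trans e.toEmbedding) (Function.extend e η' η)
    have h1 := face_face c e.toEmbedding e' η η'
    exact h1 ▸ h
  · have h := (pr_not_robustSystem_le hP hk hc).trans (hκ k hk)
    rw [pr_not, pr_eq_ncard_div] at h
    have hpos : (0 : ℝ) < Nat.card H := by
      rw [Nat.card_eq_fintype_card]; exact_mod_cast Fintype.card_pos
    rw [← le_div_iff₀ hpos]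
    linarith

lemma mem_vertexSet_robustSystem {P : (k : ℕ) → Set (DCube k → H)} {κ : ℝ} {s : ℕ} {x : H}
    (h : Fin 0 → H) (hx : angle x h ∈ robustCubes P κ (s + 1) 0) :
    x ∈ vertexSet (robustSystem P κ s) := by
  have h0 : (fun _ => x : DCube 0 → H) = angle x h := by
    funext ω; simp [angle]
  refine ⟨⟨x, h, h0⟩, fun d e η => ?_⟩
  obtain rfl : d = 0 := by
    have := Fintype.card_le_of_embedding e
    simpa using this
  have h1 : face (fun _ => x : DCube 0 → H) e η = angle x h := by
    rw [← h0]; rfl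
  rw [h1]
  exact hx

/-- If a symmetric family of sets contains almost all cubes of each dimension, then it contains a
system of cubes of parameter close to `1`. -/
lemma exists_isCubeSystem (s : ℕ) : ∃ n : ℕ, 1 ≤ n ∧ ∀ (H : Type u) [AddCommGroup H] [Fintype H]
    (P : (k : ℕ) → Set (DCube k → H)) (ε : ℝ), 0 < ε → ε ≤ 1 / 2 → IsSymmFamily P →
    (∀ d ≤ s + 1, pr (fun p : H × (Fin d → H) => angle p.1 p.2 ∉ P d) ≤ ε ^ n) →
    ∃ S : (k : ℕ) → Set (DCube k → H), IsCubeSystem s (1 - ε) S ∧ (∀ k, S k ⊆ P k) ∧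
      pr (fun x => x ∉ vertexSet S) ≤ ε := by
  set N : ℝ := 1 + ∑ k ∈ range (s + 1), (faceCount k : ℝ) with hN
  have hN1 : 1 ≤ N := le_add_of_nonneg_right (sum_nonneg fun k _ => Nat.cast_nonneg _)
  -- with `κ = ε / (2 N)` the exceptional sets may have probability `ε (κ² / 4) ^ (s + 1)`
  obtain ⟨n, hn⟩ := exists_pow_le_mul_pow (c := (1 / (4 * N)) ^ (2 * (s + 1))) (by positivity)
    (2 * (s + 1) + 1)
  refine ⟨n + 1, by omega, ?_⟩
  intro H _ _ P ε hε hε2 hP hbad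
  set κ : ℝ := ε / (2 * N) with hκ
  have hκ0 : 0 < κ := by positivity
  have hκ1 : κ ≤ 1 := by
    rw [hκ, div_le_one (by positivity)]; linarith
  refine ⟨robustSystem P κ s, isCubeSystem_robustSystem hP (by linarith) fun k hk => ?_,
    robustSystem_subset P κ s, ?_⟩
  · have h1 : (faceCount k : ℝ) ≤ N := by
      have := single_le_sum (f := fun k => (faceCount k : ℝ)) (fun k _ => Nat.cast_nonneg _)
        (mem_range.2 (Nat.lt_succ_of_le hk))
      linarith
    calc faceCount k * (2 * κ) ≤ N * (2 * κ) := by gcongr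
      _ = ε := by rw [hκ]; field_simp
  · have h1 := pr_not_robustCubes_le hκ0 hκ1 (by positivity) hbad (s + 1) 0 (by omega)
    rw [← pr_fst (β := Fin 0 → H)]
    refine (pr_mono fun p hp h => hp (mem_vertexSet_robustSystem p.2 h)).trans (h1.trans ?_)
    have h2 : ε ^ (n + 1) ≤ (1 / (4 * N)) ^ (2 * (s + 1)) * ε ^ (2 * (s + 1) + 1) :=
      (pow_le_pow_of_le_one hε.le (by linarith) (by omega)).trans (hn ε hε hε2)
    have h3 : (1 / (4 * N)) ^ (2 * (s + 1)) * ε ^ (2 * (s + 1) + 1) * (4 / κ ^ 2) ^ (s + 1) = ε := by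
      have h4 : (1 / (4 * N)) ^ 2 * ε ^ 2 * (4 / κ ^ 2) = 1 := by rw [hκ]; field_simp; norm_num
      rw [pow_succ ε, pow_mul, pow_mul ε]
      calc _ = ((1 / (4 * N)) ^ 2 * ε ^ 2 * (4 / κ ^ 2)) ^ (s + 1) * ε := by ring
        _ = ε := by rw [h4]; ring
    calc ε ^ (n + 1) * (4 / κ ^ 2) ^ (s + 1) ≤ _ :=
          mul_le_mul_of_nonneg_right h2 (by positivity)
      _ = ε := h3

end System

/-! ### From almost all cubes to a system of cubes -/

section Symmetry

variable {H : Type*}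

lemma weight_comp_perm {k : ℕ} (ω : DCube k) (σ : Equiv.Perm (Fin k)) :
    weight (ω ∘ σ : DCube k) = weight ω := by
  unfold weight
  simp only [card_filter]
  exact Equiv.sum_comp σ fun i => if ω i = true then 1 else 0

lemma neg_one_pow_weight {k : ℕ} (ω : DCube k) :
    (-1 : ℝ) ^ weight ω = ∏ i, if ω i = true then (-1 : ℝ) else 1 := by
  simp [weight, prod_ite]

lemma neg_one_pow_weight_flip {k : ℕ} (ω : DCube k) (i : Fin k) :
    (-1 : ℝ) ^ weight (Function.update ω i (!ω i)) = - (-1) ^ weight ω := by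
  classical
  rw [neg_one_pow_weight, neg_one_pow_weight, ← mul_prod_erase univ _ (mem_univ i),
    ← mul_prod_erase univ (fun j => if ω j = true then (-1 : ℝ) else 1) (mem_univ i)]
  have h1 : ∏ j ∈ univ.erase i, (if Function.update ω i (!ω i) j = true then (-1 : ℝ) else 1) =
      ∏ j ∈ univ.erase i, if ω j = true then (-1 : ℝ) else 1 :=
    prod_congr rfl fun j hj => by rw [Function.update_of_ne (ne_of_mem_erase hj)]
  rw [h1, Function.update_self]
  cases ω i <;> simp

lemma sum_weight_perm {k : ℕ} (f : DCube k → ℝ) (σ : Equiv.Perm (Fin k)) :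
    ∑ ω : DCube k, (-1 : ℝ) ^ weight ω * f (ω ∘ σ) = ∑ ω : DCube k, (-1 : ℝ) ^ weight ω * f ω := by
  rw [← Equiv.sum_comp (Equiv.arrowCongr σ.symm (Equiv.refl Bool))
    fun ω : DCube k => (-1 : ℝ) ^ weight ω * f ω]
  refine sum_congr rfl fun ω _ => ?_
  have h1 : Equiv.arrowCongr σ.symm (Equiv.refl Bool) ω = ω ∘ σ := by
    funext i; simp [Equiv.arrowCongr]
  rw [h1, weight_comp_perm]

lemma sum_weight_flip {k : ℕ} (f : DCube k → ℝ) (i : Fin k) :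
    ∑ ω : DCube k, (-1 : ℝ) ^ weight ω * f (Function.update ω i (!ω i)) =
      - ∑ ω : DCube k, (-1 : ℝ) ^ weight ω * f ω := by
  have hinv : Function.Involutive fun ω : DCube k => Function.update ω i (!ω i) := by
    intro ω
    simp
  rw [← Equiv.sum_comp (hinv.toPerm _) fun ω : DCube k => (-1 : ℝ) ^ weight ω * f ω, ← sum_neg_distrib]
  refine sum_congr rfl fun ω _ => ?_
  have h1 : (hinv.toPerm _) ω = Function.update ω i (!ω i) := rfl
  rw [h1, neg_one_pow_weight_flip]
  ring

lemma DerivAt.perm {F : ℕ → Finset (H → ℝ)} {k t : ℕ} {M : ℝ} {g : H → ℝ} {c : DCube k → H}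
    (h : DerivAt F t M g c) (σ : Equiv.Perm (Fin k)) : DerivAt F t M g fun ω => c (ω ∘ σ) := by
  obtain ⟨a, ha, he⟩ := h
  refine ⟨fun ω => a (ω ∘ σ), fun ω => ha _, ?_⟩
  unfold cubeDeriv at he ⊢
  rw [sum_weight_perm (fun ω => g (c ω)), sum_weight_perm, he]

lemma DerivAt.reflect {F : ℕ → Finset (H → ℝ)} {k t : ℕ} {M : ℝ} {g : H → ℝ} {c : DCube k → H}
    (h : DerivAt F t M g c) (i : Fin k) :
    DerivAt F t M g fun ω => c (Function.update ω i (!ω i)) := by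
  obtain ⟨a, ha, he⟩ := h
  refine ⟨fun ω => a (Function.update ω i (!ω i)), fun ω => ha _, ?_⟩
  unfold cubeDeriv at he ⊢
  rw [sum_weight_flip (fun ω => g (c ω)), sum_weight_flip, he]

/-- The configurations of dimension `k` at which the functions of level `k - 1`, and for `k = s + 1`
the function `q`, obey their derivatives conditions. -/
def derivFamily (F : ℕ → Finset (H → ℝ)) (q : H → ℝ) (s : ℕ) (K : ℝ) (k : ℕ) :
    Set (DCube k → H) :=
  {c | (k = s + 1 → DerivAt F s K q c) ∧
    ∀ i, k = i + 1 → i < s → ∀ φ ∈ F i, DerivAt F i K φ c}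

lemma isSymmFamily_derivFamily (F : ℕ → Finset (H → ℝ)) (q : H → ℝ) (s : ℕ) (K : ℝ) :
    IsSymmFamily (derivFamily F q s K) where
  perm _ _ hc σ := ⟨fun hk => (hc.1 hk).perm σ, fun i hk hi φ hφ => (hc.2 i hk hi φ hφ).perm σ⟩
  reflect _ _ hc j :=
    ⟨fun hk => (hc.1 hk).reflect j, fun i hk hi φ hφ => (hc.2 i hk hi φ hφ).reflect j⟩

lemma IsAlmostPoly.pr_derivFamily_le {H : Type*} [AddCommGroup H] [Fintype H] {s : ℕ} {ε K : ℝ}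
    {F : ℕ → Finset (H → ℝ)} {q : H → ℝ} (h : IsAlmostPoly s ε K F q) (hε : 0 ≤ ε) (d : ℕ)
    (hd : d ≤ s + 1) :
    pr (fun p : H × (Fin d → H) => angle p.1 p.2 ∉ derivFamily F q s K d) ≤ ε := by
  obtain _ | i := d
  · have h1 : ∀ p : H × (Fin 0 → H), angle p.1 p.2 ∈ derivFamily F q s K 0 := fun p =>
      ⟨fun h => by omega, fun i h => by omega⟩
    simpa [h1, pr_false] using hε
  · by_cases hi : i = s
    · subst hi
      refine (pr_mono fun p hp hp' => hp ⟨fun _ => hp', fun j hj hj' => ?_⟩).trans h.top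
      omega
    · refine (pr_mono fun p hp hp' => hp ⟨fun hj => ?_, fun j hj _ => ?_⟩).trans
        (h.level i (by omega))
      · omega
      · obtain rfl : i = j := by omega
        exact hp'

end Symmetry

section Enumeration

variable {H : Type*}

/-- The functions of a finite set, listed. -/
noncomputable def enum (F : ℕ → Finset (H → ℝ)) (i : ℕ) (j : Fin (F i).card) : H → ℝ :=
  ((F i).equivFin.symm j : H → ℝ)

lemma sum_enum (F : ℕ → Finset (H → ℝ)) (i : ℕ) (f : (H → ℝ) → ℝ) :
    ∑ j, f (enum F i j) = ∑ φ ∈ F i, f φ := by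
  unfold enum
  rw [Equiv.sum_comp (F i).equivFin.symm fun φ : F i => f φ]
  exact sum_coe_sort (F i) f

lemma derivCondition_enum {F : ℕ → Finset (H → ℝ)} {k t : ℕ} {M : ℝ} (hM : 1 ≤ M)
    {S : Set (DCube k → H)} {g : H → ℝ} (h : ∀ c ∈ S, DerivAt F t M g c) :
    DerivCondition (enum F) k t M S g := by
  refine ⟨hM, ?_⟩
  have h1 : ∀ c, ∃ b : DCube k → ℕ → (H → ℝ) → ℤ, c ∈ S →
      (∀ ω, ∀ r < t, ∑ φ ∈ F r, |(b ω r φ : ℝ)| ≤ M ^ (t - r)) ∧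
      cubeDeriv g c = ∑ ω, (-1 : ℝ) ^ weight ω *
        ∑ i ∈ range t, ∑ φ ∈ F i, (b ω i φ : ℝ) * φ (c ω) := by
    intro c
    by_cases hc : c ∈ S
    · obtain ⟨a, ha, he⟩ := h c hc
      choose b hb hb' using ha
      refine ⟨b, fun _ => ⟨hb, ?_⟩⟩
      rw [he]
      exact sum_congr rfl fun ω _ => by rw [hb' ω]
    · exact ⟨fun _ _ _ => 0, fun h => absurd h hc⟩
  choose b hb using h1
  refine ⟨fun c ω i j => b c ω i (enum F i j), fun c hc => ?_, fun c hc ω r hr => ?_⟩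
  · rw [(hb c hc).2]
    refine sum_congr rfl fun ω _ => ?_
    congr 1
    refine sum_congr rfl fun i _ => ?_
    exact (sum_enum F i fun φ => (b c ω i φ : ℝ) * φ (c ω)).symm
  · rw [sum_enum F r fun φ => |(b c ω r φ : ℝ)|]
    exact (hb c hc).1 ω r hr

end Enumeration

section ApproxPoly

variable {H : Type*} [AddCommGroup H]

lemma iterDeriv_eq_cubeDeriv {n : ℕ} (h : Fin n → H) (f : H → ℝ) (x : H) :
    iterDeriv h f x = cubeDeriv f (angle x h) := by
  induction n generalizing x with
  | zero => rw [cubeDeriv_dim_zero]; rfl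
  | succ n ih =>
    have h1 := cubeDeriv_insertNth 0 x (h 0) ((0 : Fin (n + 1)).removeNth h) f
    rw [Fin.insertNth_self_removeNth] at h1
    rw [h1]
    change iterDeriv (Fin.tail h) f x - iterDeriv (Fin.tail h) f (x + h 0) = _
    rw [ih, ih]
    have h2 : (0 : Fin (n + 1)).removeNth h = Fin.tail h := by
      funext i; simp [Fin.removeNth, Fin.tail]
    rw [h2]
    simp only [cubeDeriv, angle_add_base, mul_sub, sum_sub_distrib]

lemma IsApproxPoly.le_pr [Fintype H] {s : ℕ} {δ : ℝ} {X : Set H} {g : H → ℝ}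
    (h : IsApproxPoly s δ X g) :
    δ ≤ pr fun p : H × (Fin (s + 1) → H) =>
      (∀ ω, angle p.1 p.2 ω ∈ X) ∧ cubeDeriv g (angle p.1 p.2) = 0 := by
  have h1 := h.2
  simp only [iterDeriv_eq_cubeDeriv] at h1
  have hpos : (0 : ℝ) < Nat.card H := by
    rw [Nat.card_eq_fintype_card]; exact_mod_cast Fintype.card_pos
  have h2 : ((Nat.card (H × (Fin (s + 1) → H)) : ℕ) : ℝ) = (Nat.card H : ℝ) ^ (s + 2) := by
    rw [Nat.card_prod, Nat.card_fun, Nat.card_eq_fintype_card (α := Fin (s + 1)), Fintype.card_fin]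
    push_cast
    ring
  rw [pr_eq_ncard_div, h2, le_div_iff₀ (by positivity)]
  exact h1

/-- A function with a hierarchy on almost all cubes has a genuine hierarchy on a system of cubes. -/
lemma IsAlmostPoly.exists_system {s n : ℕ} [Fintype H] (hs : 1 ≤ s)
    (hn : ∀ (P : (k : ℕ) → Set (DCube k → H)) (ε : ℝ), 0 < ε → ε ≤ 1 / 2 → IsSymmFamily P →
      (∀ d ≤ s + 1, pr (fun p : H × (Fin d → H) => angle p.1 p.2 ∉ P d) ≤ ε ^ n) →
      ∃ S : (k : ℕ) → Set (DCube k → H), IsCubeSystem s (1 - ε) S ∧ (∀ k, S k ⊆ P k) ∧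
        pr (fun x => x ∉ vertexSet S) ≤ ε)
    {ε K : ℝ} {F : ℕ → Finset (H → ℝ)} {q : H → ℝ} (hε : 0 < ε) (hε2 : ε ≤ 1 / 2)
    (h : IsAlmostPoly s (ε ^ n) K F q) :
    ∃ S : (k : ℕ) → Set (DCube k → H), IsCubeSystem s (1 - ε) S ∧
      IsPolyHierarchy (s - 1) (fun i => (F i).card) K (enum F) S ∧
      DerivCondition (enum F) (s + 1) s K (S (s + 1)) q ∧ pr (fun x => x ∉ vertexSet S) ≤ ε := by
  obtain ⟨S, hS1, hS2, hS3⟩ := hn (derivFamily F q s K) ε hε hε2 (isSymmFamily_derivFamily F q s K)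
    fun d hd => h.pr_derivFamily_le (by positivity) d hd
  refine ⟨S, hS1, ⟨h.one_le, ⟨1 - ε, ⟨hS1.pos, fun k hk => hS1.subset_cubes k (by omega),
    fun k hk => hS1.perm k (by omega), fun k hk => hS1.reflect k (by omega),
    fun k hk => hS1.faces k (by omega), fun k hk => hS1.popular k (by omega)⟩⟩, ?_,
    fun i hi j => ?_⟩, ?_, hS3⟩
  · by_contra hne
    rw [Set.not_nonempty_iff_eq_empty] at hne
    have h1 : ∀ x, x ∉ vertexSet S := fun x hx => by
      have hx' : (fun _ => x : DCube 0 → H) ∈ S 0 := hx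
      rw [hne] at hx'
      exact hx'
    have h2 : pr (fun x => x ∉ vertexSet S) = 1 := by
      rw [pr_congr (q := fun _ : H => True) fun x => by simp [h1 x], pr_const, if_pos trivial]
    linarith
  · exact derivCondition_enum h.one_le fun c hc =>
      (hS2 _ hc).2 i rfl (by omega) _ (by simp [enum])
  · exact derivCondition_enum h.one_le fun c hc => (hS2 _ hc).1 rfl

end ApproxPoly

end PolyHier

theorem corollary2p9 (s : ℕ) (hs : 1 ≤ s) :
    ∃ C : ℕ, 0 < C ∧
      ∀ (H : Type*) [AddCommGroup H] [Finite H] (X : Set H) (g : H → ℝ) (δ ε : ℝ),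
        0 < ε → ε < 1 → PolyHier.IsApproxPoly s δ X g →
        ∃ (S : (k : ℕ) → Set (PolyHier.DCube k → H)) (d : ℕ → ℕ) (M : ℝ)
          (f : (i : ℕ) → Fin (d i) → H → ℝ) (Y : Set H) (g' : H → ℝ),
          PolyHier.IsCubeSystem s (1 - ε) S ∧
          PolyHier.IsPolyHierarchy (s - 1) d M f S ∧
          Y ⊆ PolyHier.vertexSet S ∩ X ∧
          (∀ y ∈ Y, g y = g' y) ∧
          δ ^ C / (C : ℝ) ≤ PolyHier.density Y ∧
          PolyHier.DerivCondition f (s + 1) s M (S (s + 1)) g' ∧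
          (∑ i ∈ Finset.range s, (d i : ℝ)) ≤ (C : ℝ) * ((ε * δ)⁻¹) ^ C ∧
          M ≤ (C : ℝ) * ((ε * δ)⁻¹) ^ C := by
  obtain ⟨A, hA⟩ := PolyHier.inverseStatement s
  obtain ⟨n, hn1, hn⟩ := PolyHier.exists_isCubeSystem s
  obtain ⟨E, hE⟩ : ∃ E, E = ((A + 1) * n + 1) * A := ⟨_, rfl⟩
  obtain ⟨C, hC⟩ : ∃ C, C = (s + 1) * 4 ^ E + E + A + 2 ^ (A + 1) := ⟨_, rfl⟩
  have hC0 : 0 < C := by rw [hC]; positivity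
  refine ⟨C, hC0, ?_⟩
  intro H _ _ X g δ ε hε hε1 hg
  have : Fintype H := Fintype.ofFinite H
  have hδ := hg.1
  have hpr := hg.le_pr
  have hδ1 : δ ≤ 1 := hpr.trans (PolyHier.pr_le_one _)
  -- the system misses fewer vertices than the set on which the functions agree contains
  set ε' : ℝ := ε / 2 * (δ / 2) ^ (A + 1) with hε'
  have hε'0 : 0 < ε' := by positivity
  have hδA : (δ / 2) ^ (A + 1) ≤ (δ / 2) ^ A / 2 := by
    rw [pow_succ, div_eq_mul_one_div _ (2 : ℝ)]
    exact mul_le_mul_of_nonneg_left (by linarith) (by positivity)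
  have hδA1 : (δ / 2) ^ (A + 1) ≤ 1 := pow_le_one₀ (by positivity) (by linarith)
  have hε'ε : ε' ≤ ε / 2 := mul_le_of_le_one_right (by positivity) hδA1
  have hε'δ : ε' ≤ (δ / 2) ^ A / 2 :=
    (mul_le_of_le_one_left (by positivity) (by linarith)).trans hδA
  obtain ⟨F, q, Y, hF, hYq, hY⟩ := hA H g _ (δ / 2) (ε' ^ n) (by positivity) (by linarith)
    (by positivity) ((pow_le_of_le_one hε'0.le (by linarith) (by omega)).trans (by linarith))
    (fun p hp => hp.2) (le_trans (by linarith) hpr)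
  obtain ⟨S, hS1, hS2, hS3, hS4⟩ := hF.exists_system hs (hn H) hε'0 (by linarith)
  have hεδ : ε * δ ≤ 1 := by nlinarith
  have hL : 1 ≤ (ε * δ)⁻¹ := (one_le_inv₀ (by positivity)).2 hεδ
  have hK : ((ε' ^ n * (δ / 2)) ^ A)⁻¹ ≤ 4 ^ E * ((ε * δ)⁻¹) ^ E := by
    rw [← mul_pow, hE, pow_mul, ← inv_pow]
    refine pow_le_pow_left₀ (by positivity) ?_ A
    have h1 : (4 * (ε * δ)⁻¹) = (ε / 2 * (δ / 2))⁻¹ := by field_simp; norm_num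
    rw [h1, inv_pow]
    refine inv_anti₀ (by positivity) ?_
    rw [pow_succ]
    refine mul_le_mul ?_ (mul_le_of_le_one_left (by positivity) (by linarith)) (by positivity)
      (by positivity)
    rw [pow_mul]
    refine pow_le_pow_left₀ (by positivity) ?_ n
    rw [mul_pow]
    exact mul_le_mul_of_nonneg_right (pow_le_of_le_one (by positivity) (by linarith) (by omega))
      (by positivity)
  have hEC : E ≤ C ∧ A ≤ C := by
    have h1 := Nat.zero_le ((s + 1) * 4 ^ E)
    have h2 := Nat.zero_le (2 ^ (A + 1))
    constructor <;> linarith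
  have hpow : ((ε * δ)⁻¹) ^ E ≤ ((ε * δ)⁻¹) ^ C := pow_le_pow_right₀ hL hEC.1
  have hCE : ((s : ℝ) + 1) * 4 ^ E ≤ C := by
    rw [hC]; push_cast
    have : (0 : ℝ) ≤ E + A + 2 ^ (A + 1) := by positivity
    linarith
  have h4E : (0 : ℝ) ≤ s * 4 ^ E := by positivity
  refine ⟨S, fun i => (F i).card, _, PolyHier.enum F, {y | y ∈ Y ∧ y ∈ X ∧ y ∈ PolyHier.vertexSet S},
    q, ?_, hS2, fun y hy => ⟨hy.2.2, hy.2.1⟩, fun y hy => hYq y hy.1, ?_, hS3, ?_, ?_⟩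
  · exact ⟨by linarith, hS1.subset_cubes, hS1.perm, hS1.reflect, hS1.faces, fun k hk c hc =>
      (mul_le_mul_of_nonneg_right (by linarith) (Nat.cast_nonneg _)).trans (hS1.popular k hk c hc)⟩
  · have h1 : (δ / 2) ^ A ≤ PolyHier.pr fun y => y ∈ Y ∧ y ∈ X := by
      rw [← PolyHier.pr_fst (β := Fin (s + 1) → H)]
      refine hY.trans (PolyHier.pr_mono fun p hp => ?_)
      have h0 : PolyHier.angle p.1 p.2 (fun _ => false) = p.1 := by simp [PolyHier.angle]
      exact ⟨h0 ▸ hp.2 fun _ => false, h0 ▸ hp.1.1 fun _ => false⟩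
    have h2 := PolyHier.pr_le_and_add (fun y => y ∈ Y ∧ y ∈ X) (fun y => y ∈ PolyHier.vertexSet S)
    have h3 : PolyHier.pr (fun y => (y ∈ Y ∧ y ∈ X) ∧ y ∈ PolyHier.vertexSet S) =
        PolyHier.density {y | y ∈ Y ∧ y ∈ X ∧ y ∈ PolyHier.vertexSet S} := by
      rw [PolyHier.pr_eq_ncard_div]
      simp only [and_assoc]
      rfl
    have h4 : δ ^ C / (C : ℝ) ≤ (δ / 2) ^ A / 2 := by
      have h5 : (2 : ℝ) ^ (A + 1) ≤ C := by
        rw [hC]; push_cast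
        have : (0 : ℝ) ≤ (s + 1) * 4 ^ E + E + A := by positivity
        linarith
      calc δ ^ C / (C : ℝ) ≤ δ ^ A / 2 ^ (A + 1) :=
            div_le_div₀ (by positivity) (pow_le_pow_of_le_one hδ.le hδ1 hEC.2)
              (by positivity) h5
        _ = (δ / 2) ^ A / 2 := by rw [div_pow, pow_succ]; field_simp
    linarith
  · calc (∑ i ∈ Finset.range s, ((F i).card : ℝ))
        ≤ ∑ _i ∈ Finset.range s, 4 ^ E * ((ε * δ)⁻¹) ^ E :=
          Finset.sum_le_sum fun i hi => (hF.card_le i (Finset.mem_range.1 hi)).trans hK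
      _ = (s * 4 ^ E) * ((ε * δ)⁻¹) ^ E := by
          rw [Finset.sum_const, Finset.card_range, nsmul_eq_mul, mul_assoc]
      _ ≤ C * ((ε * δ)⁻¹) ^ C :=
          mul_le_mul (by nlinarith [pow_pos (by norm_num : (0 : ℝ) < 4) E]) hpow (by positivity)
            (by positivity)
  · exact hK.trans (mul_le_mul (by linarith) hpow (by positivity) (by positivity))
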